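/- Let $K$ be an algebraically closed field, let $Q$ be a quiver with finite vertex set $Q_0$, let $I$ be an admissible ideal of the path algebra $KQ$, and let $A=KQ/I$ be finite dimensional. The product $p\cdot q$ of paths means "first $q$, then $p$", and modules are finite-dimensional left modules. For $i\in Q_0$ let $e_i$ be the trivial path at $i$, $P(i)=Ae_i$, $I(i)=\operatorname{Hom}_K(e_iA,K)$, $S(i)=\operatorname{top}P(i)$, and let $[M:S(i)]=\dim_K e_iM$ for every module $M$. Let $\leq$ be a partial order on $Q_0$. Let $\Delta(i)$ be the largest factor module of $P(i)$, and $\nabla(i)$ the largest submodule of $I(i)$, all of whose composition factors are of the form $S(k)$ with $k\leq i$. A module $M$ is $\Delta$-good if it has a finite filtration whose subquotients are isomorphic to standard modules $\Delta(k)$; $(M:\Delta(k))$ is the number of subquotients isomorphic to $\Delta(k)$ in such a filtration. Suppose that $(A,\leq)$ is 1-quasi-hereditary, that is: * $(A,\leq)$ is quasi-hereditary: for all $i,k\in Q_0$ we have $[\Delta(i):S(i)]=1$, and $P(i)$ is $\Delta$-good with $(P(i):\Delta(i))=1$ and $(P(i):\Delta(k))=0$ if $k\not\geq i$; * $(Q_0,\leq)$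 has a smallest element, denoted $1$, and a largest element, denoted $n$; * $[\Delta(i):S(j)]=(P(j):\Delta(i))=1$ for all $j\leq i$; * $\operatorname{soc}P(i)\cong\operatorname{top}I(i)\cong S(1)$ for all $i$; * for all $i$ there are a monomorphism $\Delta(i)\hookrightarrow\Delta(n)$ and an epimorphism $\nabla(n)\twoheadrightarrow\nabla(i)$. Then for all $j\leq i$ there is a path $j\to\lambda_1\to\cdots\to i$ in $Q$ with $j\leq\lambda_1\leq\cdots\leq i$, and for all $k\leq i$ there is a path $i\to\mu_1\to\cdots\to k$ in $Q$ with $i\geq\mu_1\geq\cdots\geq k$. Fix, in any way, one path $p(j,i,i)$ of the first form for all $j\leq i$ and one path $p(i,i,k)$ of the second form for all $k\leq i$. For $j,k\leq i$ let $p(j,i,k)=p(i,i,k)\cdot p(j,i,i)$, and let $\langle p(j,i,k)\rangle=A\cdot p(j,i,k)$ be the submodule of $P(j)$ generated by it. Then for all $j\leq i$ and $k\leq i$ the following hold. (a) For every $i'\in Q_0$ with $i'\geq j$ and $i'\geq k$: $\langle p(j,i',k)\rangle\subsetneq\langle p(j,i,k)\rangle$ if and only if $i'>i$. (b) For every $k'\in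 Q_0$ with $k'\leq i$: $\langle p(j,i,k')\rangle\subsetneq\langle p(j,i,k)\rangle$ if and only if $k'<k$. Moreover, for every $j\in Q_0$, the module $P(j)$ has finitely many submodules if and only if the set $\{i\in Q_0\mid i\geq j\}$ is totally ordered by $\leq$. -/

import Mathlib

open scoped Classical

universe u v w x

noncomputable section

namespace OneQH

/-! ### The path algebra of a quiver -/

/-- A path of the quiver `V`, together with its source and its target. -/
structure QPath (V : Type v) [Quiver.{w} V] where
  /-- the vertex where the path starts -/
  src : V
  /-- the vertex where the path ends -/
  tgt : V
  /-- the path itself -/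
  path : Quiver.Path src tgt

/-- The underlying vector space of the path algebra `KQ`: the paths (including the trivial ones)
form a basis. -/
def PathAlgebra (K : Type u) (V : Type v) [Field K] [Quiver.{w} V] : Type (max u v w) :=
  QPath V →₀ K

namespace PathAlgebra

variable (K : Type u) {V : Type v} [Field K] [Quiver.{w} V]

instance : AddCommGroup (PathAlgebra K V) := inferInstanceAs (AddCommGroup (QPath V →₀ K))

instance : Module K (PathAlgebra K V) := inferInstanceAs (Module K (QPath V →₀ K))

/-- The basis vector of a path. -/
def ofPath {i j : V} (p : Quiver.Path i j) : PathAlgebra K V :=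
  Finsupp.single (⟨i, j, p⟩ : QPath V) (1 : K)

/-- The product `p · q` of two paths: first `q`, then `p` if `q` ends where `p` starts, and `0`
otherwise. -/
def mulPath (p q : QPath V) : PathAlgebra K V :=
  if h : q.tgt = p.src then ofPath K (q.path.comp (p.path.cast h.symm rfl)) else 0

/-- The bilinear extension of the product of paths. -/
def mulLin : PathAlgebra K V →ₗ[K] PathAlgebra K V →ₗ[K] PathAlgebra K V :=
  Finsupp.linearCombination K (fun p : QPath V =>
    (Finsupp.linearCombination K (fun q : QPath V => mulPath K p q) :
      (QPath V →₀ K) →ₗ[K] PathAlgebra K V))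

instance : Mul (PathAlgebra K V) := ⟨fun f g => mulLin K f g⟩

instance [Fintype V] : One (PathAlgebra K V) :=
  ⟨∑ i : V, ofPath K (Quiver.Path.nil : Quiver.Path i i)⟩

theorem mul_def (f g : PathAlgebra K V) : f * g = mulLin K f g := rfl

theorem one_def [Fintype V] :
    (1 : PathAlgebra K V) = ∑ i : V, ofPath K (Quiver.Path.nil : Quiver.Path i i) := rfl

theorem mulLin_ofPath {i j k l : V} (p : Quiver.Path i j) (q : Quiver.Path k l) :
    mulLin K (ofPath K p) (ofPath K q) = mulPath K ⟨i, j, p⟩ ⟨k, l, q⟩ := by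
  unfold mulLin
  erw [Finsupp.linearCombination_single, one_smul, Finsupp.linearCombination_single, one_smul]

/-- The product of two composable paths. -/
theorem ofPath_mul_ofPath {i j k : V} (p : Quiver.Path j k) (q : Quiver.Path i j) :
    ofPath K p * ofPath K q = ofPath K (q.comp p) := by
  rw [mul_def, mulLin_ofPath]
  simp [mulPath]

/-- The product of two paths that cannot be composed. -/
theorem ofPath_mul_ofPath_of_ne {i j k l : V} (p : Quiver.Path i j) (q : Quiver.Path k l)
    (h : l ≠ i) : ofPath K p * ofPath K q = 0 := by
  rw [mul_def, mulLin_ofPath]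
  simp [mulPath, h]

/-- Induction on the elements of the path algebra. -/
theorem induction {P : PathAlgebra K V → Prop} (f : PathAlgebra K V) (h0 : P 0)
    (hadd : ∀ f g, P f → P g → P (f + g))
    (hs : ∀ (c : K) (i j : V) (p : Quiver.Path i j), P (c • ofPath K p)) : P f := by
  refine Finsupp.induction_linear f h0 (fun f g => hadd f g) ?_
  rintro ⟨i, j, p⟩ c
  have := hs c i j p
  unfold ofPath at this
  erw [Finsupp.smul_single, smul_eq_mul, mul_one] at this
  exact this

theorem mul_assoc' (f g h : PathAlgebra K V) : f * g * h = f * (g * h) := by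
  simp only [mul_def]
  induction f using PathAlgebra.induction with
  | h0 => simp
  | hadd f₁ f₂ h₁ h₂ => simp only [map_add, LinearMap.add_apply, h₁, h₂]
  | hs c i j p =>
  induction g using PathAlgebra.induction with
  | h0 => simp
  | hadd f₁ f₂ h₁ h₂ => simp only [map_add, LinearMap.add_apply, h₁, h₂]
  | hs d k l q =>
  induction h using PathAlgebra.induction with
  | h0 => simp
  | hadd f₁ f₂ h₁ h₂ => simp only [map_add, h₁, h₂]
  | hs e m n r =>
    simp only [map_smul, LinearMap.smul_apply]
    congr 3
    simp only [← mul_def]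
    by_cases h1 : l = i
    · subst h1
      rw [ofPath_mul_ofPath]
      by_cases h2 : n = k
      · subst h2
        rw [ofPath_mul_ofPath, ofPath_mul_ofPath, ofPath_mul_ofPath, Quiver.Path.comp_assoc]
      · rw [ofPath_mul_ofPath_of_ne K _ _ h2, ofPath_mul_ofPath_of_ne K _ _ h2, mul_def, map_zero]
    · rw [ofPath_mul_ofPath_of_ne K _ _ h1]
      by_cases h2 : n = k
      · subst h2
        rw [ofPath_mul_ofPath, ofPath_mul_ofPath_of_ne K _ _ h1, mul_def, map_zero,
          LinearMap.zero_apply]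
      · rw [ofPath_mul_ofPath_of_ne K _ _ h2, mul_def, mul_def, map_zero, map_zero,
          LinearMap.zero_apply]

theorem one_mul' [Fintype V] (f : PathAlgebra K V) : 1 * f = f := by
  rw [one_def, mul_def]
  induction f using PathAlgebra.induction with
  | h0 => simp
  | hadd f₁ f₂ h₁ h₂ => rw [map_add, h₁, h₂]
  | hs c i j p =>
    rw [map_smul, map_sum, LinearMap.sum_apply, Finset.sum_eq_single j]
    · rw [← mul_def, ofPath_mul_ofPath, Quiver.Path.comp_nil]
    · intro b _ hb
      rw [← mul_def, ofPath_mul_ofPath_of_ne K _ _ hb.symm]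
    · simp

theorem mul_one' [Fintype V] (f : PathAlgebra K V) : f * 1 = f := by
  rw [one_def, mul_def]
  induction f using PathAlgebra.induction with
  | h0 => simp
  | hadd f₁ f₂ h₁ h₂ => rw [map_add, LinearMap.add_apply, h₁, h₂]
  | hs c i j p =>
    rw [map_smul, LinearMap.smul_apply, map_sum, Finset.sum_eq_single i]
    · rw [← mul_def, ofPath_mul_ofPath, Quiver.Path.nil_comp]
    · intro b _ hb
      rw [← mul_def, ofPath_mul_ofPath_of_ne K _ _ hb]
    · simp

instance [Fintype V] : Ring (PathAlgebra K V) :=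
  { (inferInstance : AddCommGroup (PathAlgebra K V)) with
    mul := (· * ·)
    one := 1
    mul_assoc := mul_assoc' K
    one_mul := one_mul' K
    mul_one := mul_one' K
    left_distrib := fun f g h => by simp only [mul_def, map_add]
    right_distrib := fun f g h => by simp only [mul_def, map_add, LinearMap.add_apply]
    zero_mul := fun f => by simp only [mul_def, map_zero, LinearMap.zero_apply]
    mul_zero := fun f => by simp only [mul_def, map_zero] }

instance [Fintype V] : Algebra K (PathAlgebra K V) :=
  Algebra.ofModule
    (fun c f g => by simp only [mul_def, map_smul, LinearMap.smul_apply])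
    (fun c f g => by simp only [mul_def, map_smul])

/-- The `m`-th power of the arrow ideal: the span of all paths of length at least `m`. -/
def arrowIdealPow (V : Type v) [Quiver.{w} V] (m : ℕ) : Submodule K (PathAlgebra K V) :=
  Submodule.span K {f | ∃ (i j : V) (p : Quiver.Path i j), m ≤ p.length ∧ f = ofPath K p}

end PathAlgebra

section Presentation

variable {K : Type u} {V : Type v} {A : Type x} [Field K] [Fintype V] [Quiver.{w} V]
  [Ring A] [Algebra K A]

/-- `φ` exhibits `A` as the bound quiver algebra `KQ / I`, where `I = ker φ` is an admissible
ideal: it contains a power of the arrow ideal and is contained in the square of it. -/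
structure IsBoundQuiverPresentation (φ : PathAlgebra K V →ₐ[K] A) : Prop where
  surjective : Function.Surjective φ
  exists_pow_le : ∃ m : ℕ, PathAlgebra.arrowIdealPow K V m ≤ LinearMap.ker φ.toLinearMap
  ker_le : LinearMap.ker φ.toLinearMap ≤ PathAlgebra.arrowIdealPow K V 2

/-- The element of `A` given by a path. -/
def pathElt (φ : PathAlgebra K V →ₐ[K] A) {i j : V} (p : Quiver.Path i j) : A :=
  φ (PathAlgebra.ofPath K p)

/-- The idempotent `e i` of `A` given by the trivial path at `i`. -/
def vertexIdem (φ : PathAlgebra K V →ₐ[K] A) (i : V) : A :=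
  pathElt φ (Quiver.Path.nil : Quiver.Path i i)

end Presentation

/-! ### Top, socle, the dual of the algebra -/

/-- The top `M / rad M` of a module; `rad M` is the intersection of the maximal submodules. -/
abbrev Top (A : Type x) [Ring A] (M : Type*) [AddCommGroup M] [Module A M] : Type _ :=
  M ⧸ Module.jacobson A M

/-- The socle of a module: the sum of its simple submodules. -/
def socle (A : Type x) [Ring A] (M : Type*) [AddCommGroup M] [Module A M] : Submodule A M :=
  sSup {N | IsSimpleModule A N}

/-- The standard dual `D(A) = Hom_K(A, K)` of the right regular module, a left `A`-module. -/
def DualAlg (K : Type u) (A : Type x) [Field K] [Ring A] [Algebra K A] : Type (max u x) :=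
  A →ₗ[K] K

namespace DualAlg

variable {K : Type u} {A : Type x} [Field K] [Ring A] [Algebra K A]

instance : AddCommGroup (DualAlg K A) := inferInstanceAs (AddCommGroup (A →ₗ[K] K))

instance : Module K (DualAlg K A) := inferInstanceAs (Module K (A →ₗ[K] K))

instance : FunLike (DualAlg K A) A K := inferInstanceAs (FunLike (A →ₗ[K] K) A K)

/-- The left action on `D(A)` is `(a • f) x = f (x * a)`. -/
instance : SMul A (DualAlg K A) :=
  ⟨fun a f => (LinearMap.comp (show A →ₗ[K] K from f) (LinearMap.mulRight K a) : A →ₗ[K] K)⟩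

theorem smul_apply (a : A) (f : DualAlg K A) (y : A) : (a • f) y = f (y * a) := rfl

theorem ext_apply {f g : DualAlg K A} (h : ∀ y, f y = g y) : f = g :=
  LinearMap.ext (f := (show A →ₗ[K] K from f)) (g := (show A →ₗ[K] K from g)) h

theorem add_apply (f g : DualAlg K A) (y : A) : (f + g) y = f y + g y := rfl

theorem ksmul_apply (c : K) (f : DualAlg K A) (y : A) : (c • f) y = c * f y := rfl

theorem zero_apply (y : A) : (0 : DualAlg K A) y = 0 := rfl

theorem apply_add (f : DualAlg K A) (y z : A) : f (y + z) = f y + f z :=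
  map_add (show A →ₗ[K] K from f) y z

theorem apply_zero (f : DualAlg K A) : f 0 = 0 :=
  map_zero (show A →ₗ[K] K from f)

theorem apply_smul (f : DualAlg K A) (c : K) (y : A) : f (c • y) = c * f y :=
  map_smul (show A →ₗ[K] K from f) c y

instance : Module A (DualAlg K A) where
  one_smul f := ext_apply fun y => by rw [smul_apply, mul_one]
  mul_smul a b f := ext_apply fun y => by rw [smul_apply, smul_apply, smul_apply, mul_assoc]
  smul_zero a := ext_apply fun y => by rw [smul_apply, zero_apply, zero_apply]
  smul_add a f g := ext_apply fun y => by
    rw [smul_apply, add_apply, add_apply, smul_apply, smul_apply]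
  add_smul a b f := ext_apply fun y => by
    rw [smul_apply, add_apply, smul_apply, smul_apply, mul_add, apply_add]
  zero_smul f := ext_apply fun y => by rw [smul_apply, mul_zero, apply_zero, zero_apply]

instance : IsScalarTower K A (DualAlg K A) :=
  ⟨fun c a f => ext_apply fun y => by
    rw [smul_apply, ksmul_apply, smul_apply, mul_smul_comm, apply_smul]⟩

end DualAlg

/-! ### Projective, injective, simple, standard and costandard modules

Here `e : V → A` is the family of vertex idempotents. -/

section Modules

variable (K : Type u) {V : Type v} {A : Type x} [Field K] [Ring A] [Algebra K A] (e : V → A)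

/-- The indecomposable projective module `P(i) = A e_i`. -/
abbrev projMod (i : V) : Submodule A A := Submodule.span A {e i}

/-- The indecomposable injective module `I(i) = D(e_i A)`: the functionals on `A` which factor
through `A → e_i A`, `y ↦ e_i y`. -/
def injMod (i : V) : Submodule A (DualAlg K A) where
  carrier := {f | ∀ y, f (e i * y) = f y}
  add_mem' := fun {f g} hf hg y => by
    rw [DualAlg.add_apply, DualAlg.add_apply, hf y, hg y]
  zero_mem' := fun y => by rw [DualAlg.zero_apply, DualAlg.zero_apply]
  smul_mem' := fun a f hf y => by
    rw [DualAlg.smul_apply, DualAlg.smul_apply, mul_assoc, hf (y * a)]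

/-- The simple module `S(i)`, the top of `P(i)`. -/
abbrev simpleMod (i : V) : Type x := Top A (projMod e i)

/-- The multiplicity `[M : S(k)] = dim_K e_k M`. -/
def jhMult (M : Type*) [AddCommGroup M] [Module K M] [Module A M] [IsScalarTower K A M]
    (k : V) : ℕ :=
  Module.finrank K (LinearMap.range (Algebra.lsmul K K M (e k)))

variable [PartialOrder V]

/-- The smallest submodule `U` of `P(i)` such that `[P(i)/U : S(k)] = 0` for all `k ≰ i`. -/
def stdKer (i : V) : Submodule A (projMod e i) :=
  sInf {U | ∀ k, ¬ k ≤ i → jhMult K e (projMod e i ⧸ U) k = 0}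

/-- The standard module `Δ(i)`: the largest factor module of `P(i)` all of whose composition
factors are of the form `S(k)` with `k ≤ i`. -/
abbrev stdMod (i : V) : Type x := projMod e i ⧸ stdKer K e i

/-- The costandard module `∇(i)`: the largest submodule of `I(i)` all of whose composition
factors are of the form `S(k)` with `k ≤ i`. -/
def costdMod (i : V) : Submodule A (injMod K e i) :=
  sSup {N | ∀ k, ¬ k ≤ i → jhMult K e N k = 0}

/-- A filtration `0 = M_0 ⊆ M_1 ⊆ ⋯ ⊆ M_r = M` such that each `M_{s+1} / M_s` is isomorphic to
the standard module `Δ(idx s)`. -/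
structure StdFiltration (M : Type*) [AddCommGroup M] [Module A M] where
  /-- the number of steps -/
  r : ℕ
  /-- the submodules -/
  F : Fin (r + 1) → Submodule A M
  mono : Monotone F
  bot_eq : F 0 = ⊥
  top_eq : F (Fin.last r) = ⊤
  /-- the indices of the standard subquotients -/
  idx : Fin r → V
  subquotient : ∀ s : Fin r,
    Nonempty ((F s.succ ⧸ (F s.castSucc).submoduleOf (F s.succ)) ≃ₗ[A] stdMod K e (idx s))

/-- `M` is `Δ`-good, that is, it has a filtration by standard modules. -/
def IsStdGood (M : Type*) [AddCommGroup M] [Module A M] : Prop :=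
  Nonempty (StdFiltration K e M)

/-- The multiplicity `(M : Δ(k))`: the number of subquotients isomorphic to `Δ(k)` in a filtration
of `M` by standard modules (`0` if `M` is not `Δ`-good). -/
def stdMult (M : Type*) [AddCommGroup M] [Module A M] (k : V) : ℕ :=
  if h : Nonempty (StdFiltration K e M) then
    Nat.card {s : Fin h.some.r // h.some.idx s = k}
  else 0

/-- `(A, ≤)` is quasi-hereditary. -/
structure IsQuasiHereditary : Prop where
  std_self : ∀ i, jhMult K e (stdMod K e i) i = 1
  proj_good : ∀ i, IsStdGood K e (projMod e i)
  proj_mult_zero : ∀ i k, ¬ i ≤ k → stdMult K e (projMod e i) k = 0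
  proj_mult_self : ∀ i, stdMult K e (projMod e i) i = 1

/-- `(A, ≤)` is 1-quasi-hereditary. The smallest and the largest vertex, which have to exist,
are `⊥` and `⊤`. -/
structure IsOneQuasiHereditary [BoundedOrder V] : Prop extends IsQuasiHereditary K e where
  std_mult : ∀ i j, j ≤ i → jhMult K e (stdMod K e i) j = 1
  proj_mult : ∀ i j, j ≤ i → stdMult K e (projMod e j) i = 1
  socle_proj : ∀ i, Nonempty (socle A (projMod e i) ≃ₗ[A] simpleMod e (⊥ : V))
  top_inj : ∀ i, Nonempty (Top A (injMod K e i) ≃ₗ[A] simpleMod e (⊥ : V))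
  std_embeds : ∀ i, ∃ f : stdMod K e i →ₗ[A] stdMod K e (⊤ : V), Function.Injective f
  costd_onto : ∀ i, ∃ g : costdMod K e (⊤ : V) →ₗ[A] costdMod K e i, Function.Surjective g

end Modules

/-! ### The paths `p(j, i, k)` -/

section Paths

variable {V : Type v} [Quiver.{w} V] [PartialOrder V]

/-- A path `j → λ₁ → ⋯ → i` with `j ≤ λ₁ ≤ ⋯ ≤ i`. -/
def IsIncreasing {j : V} : ∀ {i : V}, Quiver.Path j i → Prop
  | _, Quiver.Path.nil => True
  | i, @Quiver.Path.cons _ _ _ l _ p _ => IsIncreasing p ∧ l ≤ i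

/-- A path `i → μ₁ → ⋯ → k` with `i ≥ μ₁ ≥ ⋯ ≥ k`. -/
def IsDeclining {i : V} : ∀ {k : V}, Quiver.Path i k → Prop
  | _, Quiver.Path.nil => True
  | k, @Quiver.Path.cons _ _ _ l _ p _ => IsDeclining p ∧ k ≤ l

variable (V) in
/-- A choice of an increasing path `p(j, i, i)` for all `j ≤ i` and of a declining path
`p(i, i, k)` for all `k ≤ i`. -/
structure PathSystem where
  /-- the increasing path `p(j, i, i)` -/
  up : ∀ {j i : V}, j ≤ i → Quiver.Path j i
  /-- the declining path `p(i, i, k)` -/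
  down : ∀ {i k : V}, k ≤ i → Quiver.Path i k
  up_increasing : ∀ {j i : V} (h : j ≤ i), IsIncreasing (up h)
  down_declining : ∀ {i k : V} (h : k ≤ i), IsDeclining (down h)

/-- The path `p(j, i, k)`, for `j ≤ i` and `k ≤ i`: first `p(j, i, i)`, then `p(i, i, k)`. -/
def PathSystem.p (S : PathSystem V) {j i k : V} (hj : j ≤ i) (hk : k ≤ i) : Quiver.Path j k :=
  (S.up hj).comp (S.down hk)

variable {K : Type u} {A : Type x} [Field K] [Fintype V] [Ring A] [Algebra K A]

/-- The submodule `⟨p⟩ = A · p` of `P(j)` generated by a path `p` which starts in `j`. -/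
def gen (φ : PathAlgebra K V →ₐ[K] A) {j k : V} (p : Quiver.Path j k) : Submodule A A :=
  Submodule.span A {pathElt φ p}

end Paths

end OneQH

end

/-! Let J(l) (`notLeIdeal`) be the ideal generated by the e_m with m ≰ l. Then Δ(l) = Ae_l /
J(l)e_l, and ∇(l) is the dual of e_lA / e_lJ(l). Each Δ(l) contains S(k) once for k ≤ l, and P(j) is
filtered by the Δ(l) with l ≥ j, each occurring once. Hence products d_{lk} g_{lj}, with l ≥ j and l
≥ k, form a basis of e_kAe_j adapted to the trace ideals of upper sets (`exists_isCellBasis`,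
`mem_span_of_mem_traceIdeal`). In particular dim e_kAe_j is the number of common upper bounds of j
and k.

Call an element of e_kAe_i down, and an element of e_iAe_j up, if it lies outside J(i). An arrow
cannot lie in the trace ideal of vertices other than its ends, since there only paths of length at
least two occur and the ideal of relations is admissible. So arrows between comparable vertices are
up or down, and products stay so: p(j,i,k) is a down element times an up element
(`isDownElt_pathElt`, `isUpElt_pathElt`). Conversely, a path that is up or down is monotone, which
gives existence.

The conditions on socles, tops, Δ(i) ↪ Δ(n) and ∇(n) ↠ ∇(i) make right multiplication by up elements
and left multiplication by down elements injective. Dimension counts turn this into divisibility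
(`exists_mul_up_eq`, `exists_down_mul_eq`), and a nondegenerate form on e_1Ae_1 gives divisibility
on the right by down elements (`exists_mul_down_eq`). Thus d'u' ∈ Adu whenever i ≤ i' and k' ≤ k
(`exists_mul_eq_of_le`). Trace ideals and cancellation give the converses needed for (a) and (b).

If the vertices above j form a chain, each nonzero z in e_kAe_j generates the same submodule as
e_kAe_l u_l for some l, so finitely many data determine a submodule. If i and i' above j are
incomparable, generators p and q of the two layers at vertex 1 give pairwise distinct submodules A(p
+ tq), one for each scalar t. -/

namespace OneQH

/-! ### Corners and trace ideals of a family of idempotents -/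

section Corners

variable (K : Type u) [Field K] {V : Type v} {A : Type x} [Ring A] [Algebra K A] (e : V → A)

/-- The elements fixed by left multiplication with `e k` and right multiplication with `e j`; this
is `e k * A * e j` when `e` consists of idempotents. -/
def corner (k j : V) : Submodule K A where
  carrier := {a | e k * a = a ∧ a * e j = a}
  add_mem' := fun {a b} ha hb => ⟨by rw [mul_add, ha.1, hb.1], by rw [add_mul, ha.2, hb.2]⟩
  zero_mem' := ⟨mul_zero _, zero_mul _⟩
  smul_mem' := fun c a ha =>
    ⟨by rw [mul_smul_comm, ha.1], by rw [smul_mul_assoc, ha.2]⟩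

/-- The two-sided ideal generated by the `e m` with `m ∈ U`, as a subspace. -/
def traceIdeal (U : Set V) : Submodule K A :=
  Submodule.span K {x | ∃ m ∈ U, ∃ a b : A, x = a * e m * b}

/-- The trace ideal of the vertices which are not below `l`. -/
abbrev notLeIdeal [PartialOrder V] (l : V) : Submodule K A := traceIdeal K e {m | ¬ m ≤ l}

variable {K e}

theorem mul_mem_corner {k l j : V} {a b : A} (ha : a ∈ corner K e k l) (hb : b ∈ corner K e l j) :
    a * b ∈ corner K e k j :=
  ⟨by rw [← mul_assoc, ha.1], by rw [mul_assoc, hb.2]⟩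

theorem traceIdeal_mul_left {U : Set V} {t : A} (a : A) (ht : t ∈ traceIdeal K e U) :
    a * t ∈ traceIdeal K e U := by
  induction ht using Submodule.span_induction with
  | mem x hx =>
    obtain ⟨m, hm, b, c, rfl⟩ := hx
    exact Submodule.subset_span ⟨m, hm, a * b, c, by simp only [mul_assoc]⟩
  | zero => rw [mul_zero]; exact zero_mem _
  | add x y _ _ hx hy => rw [mul_add]; exact add_mem hx hy
  | smul c x _ hx => rw [mul_smul_comm]; exact Submodule.smul_mem _ _ hx

theorem traceIdeal_mul_right {U : Set V} {t : A} (a : A) (ht : t ∈ traceIdeal K e U) :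
    t * a ∈ traceIdeal K e U := by
  induction ht using Submodule.span_induction with
  | mem x hx =>
    obtain ⟨m, hm, b, c, rfl⟩ := hx
    exact Submodule.subset_span ⟨m, hm, b, c * a, by simp only [mul_assoc]⟩
  | zero => rw [zero_mul]; exact zero_mem _
  | add x y _ _ hx hy => rw [add_mul]; exact add_mem hx hy
  | smul c x _ hx => rw [smul_mul_assoc]; exact Submodule.smul_mem _ _ hx

theorem traceIdeal_mono {U U' : Set V} (h : U ⊆ U') : traceIdeal K e U ≤ traceIdeal K e U' :=
  Submodule.span_mono fun _ ⟨m, hm, r⟩ => ⟨m, h hm, r⟩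

theorem mul_mem_traceIdeal {U : Set V} {k l : V} (hl : l ∈ U) {a : A}
    (ha : a ∈ corner K e k l) (b : A) : a * b ∈ traceIdeal K e U :=
  Submodule.subset_span ⟨l, hl, a, b, by rw [ha.2]⟩

theorem mem_traceIdeal_of_left {U : Set V} {k j : V} (hk : k ∈ U) {a : A}
    (ha : a ∈ corner K e k j) : a ∈ traceIdeal K e U :=
  Submodule.subset_span ⟨k, hk, 1, a, by rw [one_mul, ha.1]⟩

theorem mem_traceIdeal_of_right {U : Set V} {k j : V} (hj : j ∈ U) {a : A}
    (ha : a ∈ corner K e k j) : a ∈ traceIdeal K e U :=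
  Submodule.subset_span ⟨j, hj, a, 1, by rw [mul_one, ha.2]⟩

section Complete

variable [Fintype V] (he : CompleteOrthogonalIdempotents e)
include he

theorem idem_mem_corner (i : V) : e i ∈ corner K e i i := ⟨he.idem i, he.idem i⟩

theorem mul_mul_mem_corner (k j : V) (a : A) : e k * a * e j ∈ corner K e k j :=
  ⟨by rw [← mul_assoc, ← mul_assoc, (he.idem k).eq], by rw [mul_assoc, (he.idem j).eq]⟩

theorem sum_idem_mul (a : A) : ∑ k, e k * a = a := by
  rw [← Finset.sum_mul, he.complete, one_mul]

theorem sum_mul_idem (a : A) : ∑ k, a * e k = a := by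
  rw [← Finset.mul_sum, he.complete, mul_one]

end Complete

end Corners

/-! ### Consequences of the presentation -/

section Presentation

variable {K : Type u} [Field K] {V : Type v} [Quiver.{w} V]

namespace PathAlgebra

theorem ofPath_mem_arrowIdealPow {m : ℕ} {i j : V} (p : Quiver.Path i j) (h : m ≤ p.length) :
    ofPath K p ∈ arrowIdealPow K V m :=
  Submodule.subset_span ⟨i, j, p, h, rfl⟩

theorem mul_mem_arrowIdealPow [Fintype V] {m n : ℕ} {f g : PathAlgebra K V}
    (hf : f ∈ arrowIdealPow K V m) (hg : g ∈ arrowIdealPow K V n) :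
    f * g ∈ arrowIdealPow K V (m + n) := by
  rw [mul_def]
  induction hf using Submodule.span_induction with
  | zero => rw [map_zero, LinearMap.zero_apply]; exact zero_mem _
  | add x y _ _ hx hy => rw [map_add, LinearMap.add_apply]; exact add_mem hx hy
  | smul c x _ hx => rw [map_smul, LinearMap.smul_apply]; exact Submodule.smul_mem _ _ hx
  | mem x hx =>
  obtain ⟨i, j, p, hp, rfl⟩ := hx
  induction hg using Submodule.span_induction with
  | zero => rw [map_zero]; exact zero_mem _
  | add x y _ _ hx hy => rw [map_add]; exact add_mem hx hy
  | smul c x _ hx => rw [map_smul]; exact Submodule.smul_mem _ _ hx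
  | mem x hx =>
  obtain ⟨k, l, q, hq, rfl⟩ := hx
  rw [← mul_def]
  by_cases h : l = i
  · subst h
    rw [ofPath_mul_ofPath]
    exact ofPath_mem_arrowIdealPow _ (by rw [Quiver.Path.length_comp]; omega)
  · rw [ofPath_mul_ofPath_of_ne K _ _ h]
    exact zero_mem _

/-- The coefficient functional at the arrow vanishes on all paths of length at least two. -/
theorem ofPath_toPath_notMem {i j : V} (α : i ⟶ j) :
    ofPath K α.toPath ∉ arrowIdealPow K V 2 := by
  let c : PathAlgebra K V →ₗ[K] K :=
    (Finsupp.lapply (⟨i, j, α.toPath⟩ : QPath V) : (QPath V →₀ K) →ₗ[K] K)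
  have h : arrowIdealPow K V 2 ≤ LinearMap.ker c := by
    refine Submodule.span_le.2 ?_
    rintro _ ⟨k, l, p, hp, rfl⟩
    refine LinearMap.mem_ker.2 (Finsupp.single_eq_of_ne ?_)
    intro h
    injection h with h1 h2 h3
    subst h1 h2
    cases h3
    simp at hp
  intro hm
  exact one_ne_zero ((Finsupp.single_eq_same (M := K)).symm.trans (LinearMap.mem_ker.1 (h hm)))

end PathAlgebra

variable [Fintype V] {A : Type x} [Ring A] [Algebra K A] (φ : PathAlgebra K V →ₐ[K] A)

theorem pathElt_comp {i j k : V} (p : Quiver.Path i j) (q : Quiver.Path j k) :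
    pathElt φ (p.comp q) = pathElt φ q * pathElt φ p := by
  unfold pathElt
  rw [← map_mul, PathAlgebra.ofPath_mul_ofPath]

theorem pathElt_nil (i : V) : pathElt φ (Quiver.Path.nil : Quiver.Path i i) = vertexIdem φ i := rfl

theorem pathElt_cons {i j k : V} (p : Quiver.Path i j) (α : j ⟶ k) :
    pathElt φ (p.cons α) = pathElt φ α.toPath * pathElt φ p := by
  rw [← pathElt_comp]; rfl

theorem pathElt_mem_corner {i j : V} (p : Quiver.Path i j) :
    pathElt φ p ∈ corner K (vertexIdem φ) j i := by
  constructor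
  · rw [← pathElt_nil, ← pathElt_comp, Quiver.Path.comp_nil]
  · rw [← pathElt_nil, ← pathElt_comp, Quiver.Path.nil_comp]

theorem completeOrthogonalIdempotents_vertexIdem :
    CompleteOrthogonalIdempotents (vertexIdem φ) := by
  refine CompleteOrthogonalIdempotents.iff_ortho_complete.2 ⟨fun i j h => ?_, ?_⟩
  · change vertexIdem φ i * vertexIdem φ j = 0
    unfold vertexIdem pathElt
    rw [← map_mul, PathAlgebra.ofPath_mul_ofPath_of_ne K _ _ h.symm, map_zero]
  · unfold vertexIdem pathElt
    rw [← map_sum, ← PathAlgebra.one_def, map_one]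

variable {φ} (hφ : IsBoundQuiverPresentation φ)
include hφ

theorem mul_mul_mem_span_pathElt (k j : V) (a : A) :
    vertexIdem φ k * a * vertexIdem φ j ∈
      Submodule.span K (Set.range fun p : Quiver.Path j k => pathElt φ p) := by
  obtain ⟨f, rfl⟩ := hφ.surjective a
  induction f using PathAlgebra.induction with
  | h0 => simp
  | hadd f g hf hg => rw [map_add, mul_add, add_mul]; exact add_mem hf hg
  | hs c i l p =>
    rw [map_smul, mul_smul_comm, smul_mul_assoc]
    refine Submodule.smul_mem _ _ ?_
    change _ * pathElt φ p * _ ∈ _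
    have hp := pathElt_mem_corner φ p
    have he := completeOrthogonalIdempotents_vertexIdem φ
    by_cases hk : k = l
    · subst hk
      by_cases hj : i = j
      · subst hj
        rw [hp.1, hp.2]
        exact Submodule.subset_span ⟨p, rfl⟩
      · rw [← hp.2, mul_assoc, mul_assoc, he.ortho hj, mul_zero, mul_zero]
        exact zero_mem _
    · rw [← hp.1, ← mul_assoc, he.ortho hk, zero_mul, zero_mul]
      exact zero_mem _

theorem corner_le_span_pathElt (k j : V) :
    corner K (vertexIdem φ) k j ≤
      Submodule.span K (Set.range fun p : Quiver.Path j k => pathElt φ p) := by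
  intro a ha
  have := mul_mul_mem_span_pathElt hφ k j a
  rwa [ha.1, ha.2] at this

omit hφ in
variable (φ) in
/-- The image in `A` of the `m`-th power of the arrow ideal. -/
noncomputable def radPow (m : ℕ) : Submodule K A :=
  (PathAlgebra.arrowIdealPow K V m).map φ.toLinearMap

omit hφ in
theorem radPow_antitone {m n : ℕ} (h : m ≤ n) : radPow φ n ≤ radPow φ m :=
  Submodule.map_mono (Submodule.span_mono fun _ ⟨i, j, p, hp, hf⟩ => ⟨i, j, p, h.trans hp, hf⟩)

omit hφ in
theorem mul_mem_radPow {m n : ℕ} {a b : A} (ha : a ∈ radPow φ m) (hb : b ∈ radPow φ n) :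
    a * b ∈ radPow φ (m + n) := by
  obtain ⟨f, hf, rfl⟩ := ha
  obtain ⟨g, hg, rfl⟩ := hb
  exact ⟨f * g, PathAlgebra.mul_mem_arrowIdealPow hf hg, map_mul φ f g⟩

theorem corner_le_radPow_one {k j : V} (h : k ≠ j) :
    corner K (vertexIdem φ) k j ≤ radPow φ 1 := by
  refine (corner_le_span_pathElt hφ k j).trans (Submodule.span_le.2 ?_)
  rintro _ ⟨p, rfl⟩
  refine ⟨_, PathAlgebra.ofPath_mem_arrowIdealPow p ?_, rfl⟩
  cases p with
  | nil => exact absurd rfl h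
  | cons p α => simp

theorem isNilpotent_of_mem_radPow {a : A} (ha : a ∈ radPow φ 1) : IsNilpotent a := by
  obtain ⟨m, hm⟩ := hφ.exists_pow_le
  have h : ∀ n, a ^ (n + 1) ∈ radPow φ (n + 1) := by
    intro n
    induction n with
    | zero => simpa using ha
    | succ n ih => rw [pow_succ]; exact mul_mem_radPow ih ha
  obtain ⟨f, hf, hfa⟩ := radPow_antitone m.le_succ (h m)
  exact ⟨m + 1, hfa.symm.trans (LinearMap.mem_ker.1 (hm hf))⟩

/-- Otherwise the arrow would differ from a combination of longer paths by a relation, and relations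
only involve paths of length at least two. -/
theorem pathElt_toPath_notMem_radPow {i j : V} (α : i ⟶ j) :
    pathElt φ α.toPath ∉ radPow φ 2 := by
  rintro ⟨f, hf, h⟩
  apply PathAlgebra.ofPath_toPath_notMem (K := K) α
  have : PathAlgebra.ofPath K α.toPath - f ∈ LinearMap.ker φ.toLinearMap := by
    rw [LinearMap.mem_ker, map_sub, h]
    exact sub_self _
  simpa using add_mem (hφ.ker_le this) hf

/-- A path between two vertices outside `U` which passes through `U` has length at least two. -/
theorem mul_mul_mem_radPow_two {U : Set V} {k j : V} (hk : k ∉ U) (hj : j ∉ U) {t : A}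
    (ht : t ∈ traceIdeal K (vertexIdem φ) U) :
    vertexIdem φ k * t * vertexIdem φ j ∈ radPow φ 2 := by
  have he := completeOrthogonalIdempotents_vertexIdem φ
  induction ht using Submodule.span_induction with
  | mem x hx =>
    obtain ⟨m, hm, a, b, rfl⟩ := hx
    have h1 := corner_le_radPow_one hφ (ne_of_mem_of_not_mem hm hk).symm
      (mul_mul_mem_corner (K := K) he k m a)
    have h2 := corner_le_radPow_one hφ (ne_of_mem_of_not_mem hm hj)
      (mul_mul_mem_corner (K := K) he m j b)
    have := mul_mem_radPow h1 h2
    have h3 : vertexIdem φ k * a * vertexIdem φ m * (vertexIdem φ m * b * vertexIdem φ j) =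
        vertexIdem φ k * (a * vertexIdem φ m * b) * vertexIdem φ j := by
      simp only [mul_assoc]
      rw [← mul_assoc (vertexIdem φ m) (vertexIdem φ m), (he.idem m).eq]
    rwa [h3] at this
  | zero => simp
  | add x y _ _ hx hy => rw [mul_add, add_mul]; exact add_mem hx hy
  | smul c x _ hx => rw [mul_smul_comm, smul_mul_assoc]; exact Submodule.smul_mem _ _ hx

/-- An arrow between two vertices outside `U` is not contained in the trace ideal of `U`. -/
theorem pathElt_toPath_notMem_traceIdeal {U : Set V} {i j : V} (hi : i ∉ U) (hj : j ∉ U)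
    (α : i ⟶ j) : pathElt φ α.toPath ∉ traceIdeal K (vertexIdem φ) U := by
  intro h
  have hα := pathElt_mem_corner φ α.toPath
  have := mul_mul_mem_radPow_two hφ hj hi h
  rw [hα.1, hα.2] at this
  exact pathElt_toPath_notMem_radPow hφ α this

end Presentation

/-! ### Cells in the projective modules -/

section Cells

variable {K : Type u} [Field K] {V : Type v} {A : Type x} [Ring A] [Algebra K A] {e : V → A}

theorem jhMult_eq_zero_iff {M : Type*} [AddCommGroup M] [Module K M] [Module A M]
    [IsScalarTower K A M] [FiniteDimensional K M] {k : V} :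
    jhMult K e M k = 0 ↔ ∀ m : M, e k • m = 0 := by
  unfold jhMult
  rw [Submodule.finrank_eq_zero, LinearMap.range_eq_bot]
  constructor
  · intro h m
    exact LinearMap.congr_fun h m
  · intro h
    ext m
    exact h m

variable [Fintype V] (he : CompleteOrthogonalIdempotents e)

include he in
theorem mem_projMod {i : V} {a : A} : a ∈ projMod e i ↔ a * e i = a := by
  rw [Submodule.mem_span_singleton]
  constructor
  · rintro ⟨b, rfl⟩
    rw [smul_eq_mul, mul_assoc, (he.idem i).eq]
  · intro h
    exact ⟨a, h⟩

variable [PartialOrder V] [FiniteDimensional K A]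

-- This replaces quotients of P(i) by ideal membership in A: S(m) does not occur in P(i)/U exactly
-- when e_m kills the quotient, and over all m ≰ i this forces U to contain the trace ideal part.
include he in
theorem mem_stdKer {i : V} (a : projMod e i) :
    a ∈ stdKer K e i ↔ (a : A) ∈ notLeIdeal K e i := by
  let U : Submodule A (projMod e i) :=
    { carrier := {a | (a : A) ∈ notLeIdeal K e i}
      add_mem' := fun ha hb => (notLeIdeal K e i).add_mem ha hb
      zero_mem' := zero_mem (notLeIdeal K e i)
      smul_mem' := fun c _ ha => traceIdeal_mul_left c ha }
  constructor
  · intro h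
    refine (Submodule.mem_sInf.1 h) U ?_
    intro k hk
    refine jhMult_eq_zero_iff.2 fun m => ?_
    obtain ⟨b, rfl⟩ := Submodule.Quotient.mk_surjective _ m
    rw [← Submodule.Quotient.mk_smul, Submodule.Quotient.mk_eq_zero]
    exact Submodule.subset_span ⟨k, hk, 1, b, by rw [one_mul]; rfl⟩
  · intro h
    refine Submodule.mem_sInf.2 fun W hW => ?_
    -- The spanning elements of the trace ideal need not lie in P(i), so the induction is on x but
    -- speaks of `x * e i`.
    have key : ∀ x ∈ notLeIdeal K e i, ∀ hx : x * e i ∈ projMod e i,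
        (⟨x * e i, hx⟩ : projMod e i) ∈ W := by
      intro x hx
      induction hx using Submodule.span_induction with
      | mem x hx =>
        obtain ⟨m, hm, b, c, rfl⟩ := hx
        intro hx
        have hc : c * e i ∈ projMod e i :=
          Submodule.smul_mem _ _ (Submodule.mem_span_singleton_self _)
        have := jhMult_eq_zero_iff.1 (hW m hm) (Submodule.Quotient.mk ⟨c * e i, hc⟩)
        rw [← Submodule.Quotient.mk_smul, Submodule.Quotient.mk_eq_zero] at this
        convert W.smul_mem b this using 1
        ext
        simp [mul_assoc]
      | zero =>
        intro hx
        convert W.zero_mem using 1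
        ext
        simp
      | add x y _ _ hx hy =>
        intro hxy
        have h1 : ∀ z : A, z * e i ∈ projMod e i := fun z =>
          Submodule.smul_mem _ _ (Submodule.mem_span_singleton_self _)
        convert W.add_mem (hx (h1 x)) (hy (h1 y)) using 1
        ext
        simp [add_mul]
      | smul c x _ hx =>
        intro hcx
        have h1 : x * e i ∈ projMod e i :=
          Submodule.smul_mem _ _ (Submodule.mem_span_singleton_self _)
        have h2 : (⟨c • x * e i, hcx⟩ : projMod e i) = c • ⟨x * e i, h1⟩ := Subtype.ext (by simp)
        rw [h2]
        exact (W.restrictScalars K).smul_mem c (hx h1)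
    have ha := (mem_projMod he).1 a.2
    convert key a h (by rw [ha]; exact a.2) using 1
    ext
    exact ha.symm

include he in
/-- If `[Δ(l) : S(k)] = 1`, every element of `corner k l` outside the kernel of `P(l) → Δ(l)` spans
`corner k l` modulo that kernel. -/
theorem exists_sub_smul_mem {k l : V} (h : jhMult K e (stdMod K e l) k = 1) {d a : A}
    (hd : d ∈ corner K e k l) (hd' : d ∉ notLeIdeal K e l) (ha : a ∈ corner K e k l) :
    ∃ c : K, a - c • d ∈ notLeIdeal K e l := by
  have hmem : ∀ b ∈ corner K e k l, b ∈ projMod e l := fun b hb => (mem_projMod he).2 hb.2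
  have hr : ∀ b (hb : b ∈ corner K e k l), (Submodule.Quotient.mk ⟨b, hmem b hb⟩ : stdMod K e l) ∈
      LinearMap.range (Algebra.lsmul K K (stdMod K e l) (e k)) := by
    intro b hb
    refine ⟨Submodule.Quotient.mk ⟨b, hmem b hb⟩, ?_⟩
    rw [Algebra.lsmul_apply, ← Submodule.Quotient.mk_smul]
    congr 1
    ext
    exact hb.1
  have hd0 : (⟨_, hr d hd⟩ : LinearMap.range (Algebra.lsmul K K (stdMod K e l) (e k))) ≠ 0 := by
    intro h0
    have := congrArg Subtype.val h0
    exact hd' ((mem_stdKer he _).1 ((Submodule.Quotient.mk_eq_zero _).1 this))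
  obtain ⟨c, hc⟩ := exists_smul_eq_of_finrank_eq_one h hd0 ⟨_, hr a ha⟩
  refine ⟨c, ?_⟩
  have h1 := congrArg Subtype.val hc
  have h2 : (Submodule.Quotient.mk (⟨a, hmem a ha⟩ - c • ⟨d, hmem d hd⟩) : stdMod K e l) = 0 := by
    rw [Submodule.Quotient.mk_sub, sub_eq_zero]
    exact h1.symm
  exact (mem_stdKer he _).1 ((Submodule.Quotient.mk_eq_zero _).1 h2)

include he in
theorem exists_mem_corner_notMem {k l : V} (h : jhMult K e (stdMod K e l) k = 1) :
    ∃ d ∈ corner K e k l, d ∉ notLeIdeal K e l := by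
  by_contra! hc
  have h0 : jhMult K e (stdMod K e l) k = 0 := by
    refine jhMult_eq_zero_iff.2 fun m => ?_
    obtain ⟨b, rfl⟩ := Submodule.Quotient.mk_surjective _ m
    rw [← Submodule.Quotient.mk_smul, Submodule.Quotient.mk_eq_zero, mem_stdKer he]
    apply hc
    have := mul_mul_mem_corner (K := K) he k l b
    rwa [mul_assoc, (mem_projMod he).1 b.2] at this
  omega

include he in
/-- The steps of a filtration by standard modules are generated by one element each. -/
theorem StdFiltration.exists_generator {M : Type*} [AddCommGroup M] [Module A M]
    (F : StdFiltration K e M) (s : Fin F.r) :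
    ∃ g : M, e (F.idx s) • g = g ∧ g ∈ F.F s.succ ∧
      (∀ a : A, a * e (F.idx s) = a →
        (a • g ∈ F.F s.castSucc ↔ a ∈ notLeIdeal K e (F.idx s))) ∧
      ∀ f ∈ F.F s.succ, ∃ b : A, b * e (F.idx s) = b ∧ f - b • g ∈ F.F s.castSucc := by
  obtain ⟨Φ⟩ := F.subquotient s
  set l := F.idx s with hl
  set N := (F.F s.castSucc).submoduleOf (F.F s.succ) with hN
  have hel : e l ∈ projMod e l := Submodule.mem_span_singleton_self _
  obtain ⟨g, hg⟩ := Submodule.Quotient.mk_surjective N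
    (Φ.symm (Submodule.Quotient.mk ⟨e l, hel⟩))
  have hproj : ∀ b : A, b * e l = b → b ∈ projMod e l := fun b hb => (mem_projMod he).2 hb
  have hmk : ∀ (b : A) (hb : b * e l = b),
      (Submodule.Quotient.mk (b • e l • g) : F.F s.succ ⧸ N) =
        Φ.symm (Submodule.Quotient.mk ⟨b, hproj b hb⟩) := by
    intro b hb
    rw [Submodule.Quotient.mk_smul, Submodule.Quotient.mk_smul, hg, ← map_smul, ← map_smul,
      ← Submodule.Quotient.mk_smul, ← Submodule.Quotient.mk_smul]
    congr 2
    ext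
    simp [(he.idem l).eq, hb]
  have hmemN : ∀ y : F.F s.succ, y ∈ N ↔ (y : M) ∈ F.F s.castSucc := fun y => Iff.rfl
  refine ⟨e l • g, ?_, (F.F s.succ).smul_mem _ g.2, ?_, ?_⟩
  · rw [← mul_smul, (he.idem l).eq]
  · intro a ha
    have h1 := hmemN (a • e l • g)
    rw [← Submodule.Quotient.mk_eq_zero, hmk a ha, LinearEquiv.map_eq_zero_iff,
      Submodule.Quotient.mk_eq_zero, mem_stdKer he] at h1
    exact h1.symm
  · intro f hf
    obtain ⟨b, hb⟩ := Submodule.Quotient.mk_surjective _ (Φ (Submodule.Quotient.mk ⟨f, hf⟩))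
    have hb' := (mem_projMod he).1 b.2
    refine ⟨b, hb', ?_⟩
    refine (hmemN (⟨f, hf⟩ - (b : A) • e l • g)).1 ?_
    rw [← Submodule.Quotient.mk_eq_zero, Submodule.Quotient.mk_sub, hmk b hb', sub_eq_zero]
    exact (LinearEquiv.eq_symm_apply Φ).2 hb.symm

variable {d : V → V → A}

-- Each filtration step is a copy of Δ(l) on a generator, so its e_k-part is one line if k ≤ l and
-- zero otherwise. Lifting these lines gives a basis of e_kM.
include he in
theorem StdFiltration.exists_basis {M : Type*} [AddCommGroup M] [Module K M] [Module A M]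
    [IsScalarTower K A M] (F : StdFiltration K e M)
    (hstd : ∀ l k, k ≤ l → jhMult K e (stdMod K e l) k = 1)
    (hd : ∀ l k, k ≤ l → d l k ∈ corner K e k l ∧ d l k ∉ notLeIdeal K e l) :
    ∃ g : Fin F.r → M, (∀ s, e (F.idx s) • g s = g s) ∧
      ∀ k, (∀ f : M, e k • f = f →
          f ∈ Submodule.span K ((fun s => d (F.idx s) k • g s) '' {s | k ≤ F.idx s})) ∧
        LinearIndepOn K (fun s => d (F.idx s) k • g s) {s | k ≤ F.idx s} := by
  choose g hg hgF hgK hgS using F.exists_generator he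
  refine ⟨g, hg, fun k => ⟨?_, ?_⟩⟩
  · have key : ∀ s : Fin (F.r + 1), ∀ f ∈ F.F s, e k • f = f →
        f ∈ Submodule.span K ((fun s => d (F.idx s) k • g s) '' {s | k ≤ F.idx s}) := by
      intro s
      induction s using Fin.induction with
      | zero =>
        intro f hf _
        rw [F.bot_eq, Submodule.mem_bot] at hf
        rw [hf]
        exact zero_mem _
      | succ s ih =>
        intro f hf hkf
        obtain ⟨b, hb, hfb⟩ := hgS s f hf
        have hkb : e k * b ∈ corner K e k (F.idx s) := by
          have := mul_mul_mem_corner (K := K) he k (F.idx s) b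
          rwa [mul_assoc, hb] at this
        have h1 : f - (e k * b) • g s ∈ F.F s.castSucc := by
          have := (F.F s.castSucc).smul_mem (e k) hfb
          rwa [smul_sub, hkf, ← mul_smul] at this
        by_cases hk : k ≤ F.idx s
        · obtain ⟨c, hc⟩ := exists_sub_smul_mem he (hstd _ _ hk) (hd _ _ hk).1 (hd _ _ hk).2 hkb
          have hdk := (hd _ _ hk).1
          have h2 : f - c • d (F.idx s) k • g s ∈ F.F s.castSucc := by
            have h3 := (hgK s (e k * b - c • d (F.idx s) k)
              (by rw [sub_mul, smul_mul_assoc, hdk.2, hkb.2])).2 hc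
            have := add_mem h1 h3
            rwa [sub_smul, smul_assoc, sub_add_sub_cancel] at this
          have h4 := ih _ h2 (by
            rw [smul_sub, hkf, ← smul_assoc c, ← mul_smul, mul_smul_comm, hdk.1])
          have h5 : d (F.idx s) k • g s ∈
              Submodule.span K ((fun s => d (F.idx s) k • g s) '' {s | k ≤ F.idx s}) :=
            Submodule.subset_span ⟨s, hk, rfl⟩
          simpa using add_mem h4 (Submodule.smul_mem _ c h5)
        · have h3 := (hgK s (e k * b) hkb.2).2 (mem_traceIdeal_of_left hk hkb)
          have := add_mem h1 h3
          rw [sub_add_cancel] at this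
          exact ih f this hkf
    intro f hf
    exact key (Fin.last _) f (by rw [F.top_eq]; trivial) hf
  · rw [linearIndepOn_iff']
    intro t c ht h0
    by_contra! hne
    have hne' : (t.filter fun s => c s ≠ 0).Nonempty := by
      obtain ⟨s, hs, hs'⟩ := hne
      exact ⟨s, Finset.mem_filter.2 ⟨hs, hs'⟩⟩
    -- In a relation, the last step with nonzero coefficient would lie in the preceding submodule,
    -- against the choice of `d`.
    set m := (t.filter fun s => c s ≠ 0).max' hne'
    obtain ⟨hmt, hcm⟩ := Finset.mem_filter.1 (Finset.max'_mem _ hne')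
    have hk : k ≤ F.idx m := ht hmt
    rw [← Finset.add_sum_erase t _ hmt] at h0
    have h1 : ∑ s ∈ t.erase m, c s • d (F.idx s) k • g s ∈
        ((F.F m.castSucc).restrictScalars K : Submodule K M) := by
      refine sum_mem fun s hs => ?_
      obtain ⟨hsm, hst⟩ := Finset.mem_erase.1 hs
      by_cases hcs : c s = 0
      · rw [hcs, zero_smul]; exact zero_mem _
      · refine Submodule.smul_mem _ _ ?_
        have hlt : s < m :=
          lt_of_le_of_ne (Finset.le_max' _ _ (Finset.mem_filter.2 ⟨hst, hcs⟩)) hsm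
        exact F.mono (Fin.succ_le_castSucc_iff.2 hlt) ((F.F s.succ).smul_mem _ (hgF s))
    have h2 : c m • d (F.idx m) k • g m ∈
        ((F.F m.castSucc).restrictScalars K : Submodule K M) := by
      rw [eq_neg_of_add_eq_zero_left h0]
      exact neg_mem h1
    have h3 := (Submodule.smul_mem_iff _ hcm).1 h2
    exact (hd _ _ hk).2 ((hgK m _ (hd _ _ hk).1.2).1 h3)

end Cells

/-! ### The cell basis of A and its compatibility with trace ideals. -/

section CellBasis

variable {K : Type u} [Field K] {V : Type v} {A : Type x} [Ring A] [Algebra K A] {e : V → A}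
  [PartialOrder V]

variable (K e) in
/-- The elements `d l k * g l j` with `l ≥ j, k` form a basis of each `corner k j`; the element
`d l k` spans `corner k l` modulo the kernel of `P(l) → Δ(l)`. -/
structure IsCellBasis (d g : V → V → A) : Prop where
  d_mem : ∀ {l k}, k ≤ l → d l k ∈ corner K e k l
  d_notMem : ∀ {l k}, k ≤ l → d l k ∉ notLeIdeal K e l
  g_mem : ∀ {l j}, j ≤ l → g l j ∈ corner K e l j
  sub_smul_mem : ∀ {l k}, k ≤ l → ∀ {d a : A}, d ∈ corner K e k l → d ∉ notLeIdeal K e l →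
    a ∈ corner K e k l → ∃ c : K, a - c • d ∈ notLeIdeal K e l
  corner_le_span : ∀ k j,
    corner K e k j ≤ Submodule.span K ((fun l => d l k * g l j) '' {l | j ≤ l ∧ k ≤ l})
  linearIndepOn : ∀ k j, LinearIndepOn K (fun l => d l k * g l j) {l | j ≤ l ∧ k ≤ l}

variable [Fintype V] (he : CompleteOrthogonalIdempotents e)

-- In the filtration of P(j) each Δ(l) with l ≥ j occurs exactly once and no other occurs, so its
-- steps can be indexed by the vertices l ≥ j.
include he in
theorem exists_isCellBasis [FiniteDimensional K A] (hq : IsQuasiHereditary K e)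
    (hstd : ∀ i j, j ≤ i → jhMult K e (stdMod K e i) j = 1)
    (hproj : ∀ i j, j ≤ i → stdMult K e (projMod e j) i = 1) :
    ∃ d g : V → V → A, IsCellBasis K e d g := by
  have hex : ∀ l k, ∃ d : A, k ≤ l → d ∈ corner K e k l ∧ d ∉ notLeIdeal K e l := by
    intro l k
    by_cases h : k ≤ l
    · obtain ⟨d, hd⟩ := exists_mem_corner_notMem he (hstd l k h)
      exact ⟨d, fun _ => hd⟩
    · exact ⟨0, fun h' => absurd h' h⟩
  choose d hd using hex
  have hg : ∀ j, ∃ g : V → A, (∀ l, j ≤ l → g l ∈ corner K e l j) ∧ ∀ k,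
      corner K e k j ≤ Submodule.span K ((fun l => d l k * g l) '' {l | j ≤ l ∧ k ≤ l}) ∧
      LinearIndepOn K (fun l => d l k * g l) {l | j ≤ l ∧ k ≤ l} := by
    intro j
    have hF : Nonempty (StdFiltration K e (projMod e j)) := hq.proj_good j
    have hmult : ∀ l, Nat.card {s : Fin hF.some.r // hF.some.idx s = l} =
        if j ≤ l then 1 else 0 := by
      intro l
      have h1 : stdMult K e (projMod e j) l =
          Nat.card {s : Fin hF.some.r // hF.some.idx s = l} := by
        unfold stdMult
        rw [dif_pos hF]
      rw [← h1]
      split_ifs with h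
      · exact hproj l j h
      · exact hq.proj_mult_zero j l h
    -- The multiplicities are counted in one chosen filtration; that filtration must be the one used
    -- below.
    generalize hF.some = F at hmult
    have hle : ∀ s, j ≤ F.idx s := by
      intro s
      by_contra h
      have := hmult (F.idx s)
      rw [if_neg h, Finite.card_eq_zero_iff] at this
      exact this.false ⟨s, rfl⟩
    have hinj : Function.Injective F.idx := by
      intro s s' h
      have := hmult (F.idx s')
      rw [if_pos (hle s')] at this
      have hsub := (Nat.card_eq_one_iff_unique.1 this).1
      exact congrArg Subtype.val (hsub.elim ⟨s, h⟩ ⟨s', rfl⟩)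
    have hsurj : ∀ l, j ≤ l → ∃ s, F.idx s = l := by
      intro l h
      have := hmult l
      rw [if_pos h] at this
      obtain ⟨⟨s, hs⟩⟩ := (Nat.card_eq_one_iff_unique.1 this).2
      exact ⟨s, hs⟩
    obtain ⟨γ, hγ, hγ'⟩ := F.exists_basis he hstd hd
    let g : V → A := Function.extend F.idx (fun s => (γ s : A)) 0
    have hgs : ∀ s, g (F.idx s) = γ s := fun s => hinj.extend_apply _ _ s
    have himg : ∀ k, F.idx '' {s | k ≤ F.idx s} = {l | j ≤ l ∧ k ≤ l} := by
      intro k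
      ext l
      constructor
      · rintro ⟨s, hs, rfl⟩
        exact ⟨hle s, hs⟩
      · rintro ⟨h1, h2⟩
        obtain ⟨s, rfl⟩ := hsurj l h1
        exact ⟨s, h2, rfl⟩
    refine ⟨g, ?_, fun k => ⟨?_, ?_⟩⟩
    · intro l hl
      obtain ⟨s, rfl⟩ := hsurj l hl
      rw [hgs]
      exact ⟨congrArg Subtype.val (hγ s), (mem_projMod he).1 (γ s).2⟩
    · intro a ha
      have h1 := (hγ' k).1 ⟨a, (mem_projMod he).2 ha.2⟩ (Subtype.ext ha.1)
      have h2 := Submodule.mem_map_of_mem (f := ((projMod e j).subtype.restrictScalars K)) h1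
      rw [Submodule.map_span, ← Set.image_comp] at h2
      rw [← himg, ← Set.image_comp]
      convert h2 using 3
      · simp [hgs]
      · rfl
    · rw [← himg]
      refine LinearIndepOn.image_of_comp F.idx _ ?_
      have h2 := (hγ' k).2.map_injOn ((projMod e j).subtype.restrictScalars K)
        (Subtype.val_injective.injOn)
      convert h2 using 1
      ext s
      simp [hgs]
  choose g hg hg' using hg
  exact ⟨d, fun l j => g j l, fun h => (hd _ _ h).1, fun h => (hd _ _ h).2, fun h => hg _ _ h,
    fun h => exists_sub_smul_mem he (hstd _ _ h), fun k j => (hg' j k).1, fun k j => (hg' j k).2⟩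

omit [Fintype V] in
theorem le_of_notMem_notLeIdeal_left {k l : V} {a : A} (ha : a ∈ corner K e k l)
    (h : a ∉ notLeIdeal K e l) : k ≤ l := by
  by_contra hk
  exact h (mem_traceIdeal_of_left hk ha)

omit [Fintype V] in
theorem le_of_notMem_notLeIdeal_right {l j : V} {a : A} (ha : a ∈ corner K e l j)
    (h : a ∉ notLeIdeal K e l) : j ≤ l := by
  by_contra hj
  exact h (mem_traceIdeal_of_right hj ha)

namespace IsCellBasis

variable {d g : V → V → A} (B : IsCellBasis K e d g)
include B

omit [Fintype V] in
theorem corner_eq_span (k j : V) :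
    corner K e k j = Submodule.span K ((fun l => d l k * g l j) '' {l | j ≤ l ∧ k ≤ l}) := by
  refine le_antisymm (B.corner_le_span k j) (Submodule.span_le.2 ?_)
  rintro _ ⟨l, ⟨h1, h2⟩, rfl⟩
  exact mul_mem_corner (B.d_mem h2) (B.g_mem h1)

theorem finrank_corner (k j : V) :
    Module.finrank K (corner K e k j) = Nat.card {l | j ≤ l ∧ k ≤ l} := by
  rw [B.corner_eq_span, Set.image_eq_range, Nat.card_eq_fintype_card]
  exact finrank_span_eq_card (B.linearIndepOn k j)

-- Multiplication can only move cells upwards. The induction descends from the large vertices: a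
-- product through e_l is a multiple of the cell at l up to terms through vertices strictly above l.
include he in
theorem mul_mem_span (l : V) : ∀ {k j : V} {a b : A}, a ∈ corner K e k l → b ∈ corner K e l j →
    a * b ∈ Submodule.span K ((fun m => d m k * g m j) '' {m | l ≤ m ∧ j ≤ m ∧ k ≤ m}) := by
  induction l using WellFoundedGT.induction with
  | ind l ih =>
  intro k j a b ha hb
  have hmono : ∀ m, l ≤ m →
      Submodule.span K ((fun m => d m k * g m j) '' {m' | m ≤ m' ∧ j ≤ m' ∧ k ≤ m'}) ≤
      Submodule.span K ((fun m => d m k * g m j) '' {m | l ≤ m ∧ j ≤ m ∧ k ≤ m}) := fun m hm =>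
    Submodule.span_mono (Set.image_mono fun m' h => ⟨hm.trans h.1, h.2⟩)
  have hT : ∀ t ∈ notLeIdeal K e l, ∀ h ∈ corner K e l j, e k * t * h ∈
      Submodule.span K ((fun m => d m k * g m j) '' {m | l ≤ m ∧ j ≤ m ∧ k ≤ m}) := by
    intro t ht h hh
    induction ht using Submodule.span_induction with
    | zero => rw [mul_zero, zero_mul]; exact zero_mem _
    | add x y _ _ hx hy => rw [mul_add, add_mul]; exact add_mem hx hy
    | smul c x _ hx => rw [mul_smul_comm, smul_mul_assoc]; exact Submodule.smul_mem _ _ hx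
    | mem x hx =>
      obtain ⟨m, hm, p, q, rfl⟩ := hx
      have hp := mul_mul_mem_corner (K := K) he k m p
      have hq := B.corner_le_span _ _ (mul_mul_mem_corner (K := K) he m l q)
      have heq : e k * (p * e m * q) * h = (e k * p * e m) * (e m * q * e l * h) := by
        simp only [mul_assoc]
        rw [hh.1, ← mul_assoc (e m) (e m), (he.idem m).eq]
      rw [heq]
      generalize e m * q * e l = z at hq
      induction hq using Submodule.span_induction with
      | zero => rw [zero_mul, mul_zero]; exact zero_mem _
      | add x y _ _ hx hy => rw [add_mul, mul_add]; exact add_mem hx hy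
      | smul c x _ hx => rw [smul_mul_assoc, mul_smul_comm]; exact Submodule.smul_mem _ _ hx
      | mem x hx =>
        obtain ⟨m', ⟨h1, h2⟩, rfl⟩ := hx
        -- The middle factor goes from l to some m ≰ l, so its cells lie above both and cannot be l
        -- itself.
        have hlt : l < m' := lt_of_le_of_ne h1 fun h => hm (h ▸ h2)
        have := ih m' hlt (mul_mem_corner hp (B.d_mem h2)) (mul_mem_corner (B.g_mem h1) hh)
        rw [mul_assoc, mul_assoc] at this
        rw [mul_assoc]
        simp only [mul_assoc] at this ⊢
        exact hmono m' h1 this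
  have hb' := B.corner_le_span _ _ hb
  clear hb
  induction hb' using Submodule.span_induction with
  | zero => rw [mul_zero]; exact zero_mem _
  | add x y _ _ hx hy => rw [mul_add]; exact add_mem hx hy
  | smul c x _ hx => rw [mul_smul_comm]; exact Submodule.smul_mem _ _ hx
  | mem x hx =>
    obtain ⟨m, ⟨h1, h2⟩, rfl⟩ := hx
    dsimp only
    rw [← mul_assoc]
    have had := mul_mem_corner ha (B.d_mem h2)
    rcases h2.eq_or_lt with rfl | hlt
    · by_cases hk : k ≤ l
      · obtain ⟨c, hc⟩ := B.sub_smul_mem hk (B.d_mem hk) (B.d_notMem hk) had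
        have h3 := hT _ hc _ (B.g_mem h1)
        rw [mul_sub, had.1, mul_smul_comm, (B.d_mem hk).1, sub_mul, smul_mul_assoc] at h3
        have h4 : d l k * g l j ∈
            Submodule.span K ((fun m => d m k * g m j) '' {m | l ≤ m ∧ j ≤ m ∧ k ≤ m}) :=
          Submodule.subset_span ⟨l, ⟨le_rfl, h1, hk⟩, rfl⟩
        simpa using add_mem h3 (Submodule.smul_mem _ c h4)
      · have h3 := hT _ (mem_traceIdeal_of_left hk had) _ (B.g_mem h1)
        rwa [had.1] at h3
    · exact hmono m h2 (ih m hlt had (B.g_mem h1))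

include he in
/-- The part of `corner k j` in the trace ideal of an upper set is spanned by basis elements. -/
theorem mem_span_of_mem_traceIdeal {U : Set V} (hU : IsUpperSet U) {k j : V} {t : A}
    (ht : t ∈ traceIdeal K e U) : e k * t * e j ∈
      Submodule.span K ((fun m => d m k * g m j) '' {m | m ∈ U ∧ j ≤ m ∧ k ≤ m}) := by
  induction ht using Submodule.span_induction with
  | zero => rw [mul_zero, zero_mul]; exact zero_mem _
  | add x y _ _ hx hy => rw [mul_add, add_mul]; exact add_mem hx hy
  | smul c x _ hx => rw [mul_smul_comm, smul_mul_assoc]; exact Submodule.smul_mem _ _ hx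
  | mem x hx =>
    obtain ⟨m, hm, p, q, rfl⟩ := hx
    have h1 := B.mul_mem_span he m (mul_mul_mem_corner (K := K) he k m p)
      (mul_mul_mem_corner (K := K) he m j q)
    have heq : e k * (p * e m * q) * e j = (e k * p * e m) * (e m * q * e j) := by
      simp only [mul_assoc]
      rw [← mul_assoc (e m) (e m), (he.idem m).eq]
    rw [heq]
    refine Submodule.span_mono (Set.image_mono ?_) h1
    exact fun m' h => ⟨hU h.1 hm, h.2⟩

omit B [Fintype V] in
theorem isUpperSet_notLe (l : V) : IsUpperSet {m | ¬ m ≤ l} := fun _ _ h hm h' => hm (h.trans h')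

-- The part of the ideal in `corner k j` is spanned by other basis elements, so linear independence
-- excludes this one.
include he in
theorem basis_notMem {l k j : V} (hk : k ≤ l) (hj : j ≤ l) :
    d l k * g l j ∉ notLeIdeal K e l := by
  intro h
  have h1 := B.mem_span_of_mem_traceIdeal he (isUpperSet_notLe l) (k := k) (j := j) h
  have h2 := mul_mem_corner (B.d_mem hk) (B.g_mem hj)
  rw [h2.1, h2.2] at h1
  refine (B.linearIndepOn k j).notMem_span (i := l) ⟨hj, hk⟩
    (Submodule.span_mono (Set.image_mono ?_) h1)
  rintro m ⟨h3, h4⟩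
  exact ⟨h4, fun h => h3 (by rw [h])⟩

omit [Fintype V] in
/-- Modulo the trace ideal of the vertices not below `l`, the space `corner l j` is spanned by
`d l l * g l j`. -/
theorem exists_sub_smul_basis_mem {l j : V} (hj : j ≤ l) {b : A} (hb : b ∈ corner K e l j) :
    ∃ c : K, b - c • (d l l * g l j) ∈ notLeIdeal K e l := by
  have h : corner K e l j ≤ K ∙ (d l l * g l j) ⊔ notLeIdeal K e l := by
    refine (B.corner_le_span l j).trans (Submodule.span_le.2 ?_)
    rintro _ ⟨m, ⟨h1, h2⟩, rfl⟩
    by_cases hm : m ≤ l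
    · obtain rfl := le_antisymm hm h2
      exact Submodule.mem_sup_left (Submodule.mem_span_singleton_self _)
    · exact Submodule.mem_sup_right (mul_mem_traceIdeal hm (B.d_mem h2) _)
  obtain ⟨y, hy, z, hz, rfl⟩ := Submodule.mem_sup.1 (h hb)
  obtain ⟨c, rfl⟩ := Submodule.mem_span_singleton.1 hy
  exact ⟨c, by simpa using hz⟩

omit [Fintype V] in
theorem sub_smul_mem_right {l j : V} {u b : A} (hu : u ∈ corner K e l j)
    (hu' : u ∉ notLeIdeal K e l) (hb : b ∈ corner K e l j) :
    ∃ c : K, b - c • u ∈ notLeIdeal K e l := by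
  have hj := le_of_notMem_notLeIdeal_right hu hu'
  obtain ⟨c, hc⟩ := B.exists_sub_smul_basis_mem hj hu
  obtain ⟨c', hc'⟩ := B.exists_sub_smul_basis_mem hj hb
  have hc0 : c ≠ 0 := by
    rintro rfl
    rw [zero_smul, sub_zero] at hc
    exact hu' hc
  refine ⟨c' * c⁻¹, ?_⟩
  have := sub_mem hc' (Submodule.smul_mem _ (c' * c⁻¹) hc)
  rw [smul_sub, smul_smul, mul_assoc, inv_mul_cancel₀ hc0, mul_one,
    sub_sub_sub_cancel_right] at this
  exact this

-- Modulo the ideal, `d l k` is a multiple of `a` and `g l j` a multiple of `u`. If `a * u` vanished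
-- there, so would the basis element `d l k * g l j`.
include he in
theorem mul_notMem {k l j : V} {a u : A} (ha : a ∈ corner K e k l) (ha' : a ∉ notLeIdeal K e l)
    (hu : u ∈ corner K e l j) (hu' : u ∉ notLeIdeal K e l) : a * u ∉ notLeIdeal K e l := by
  intro h
  have hk := le_of_notMem_notLeIdeal_left ha ha'
  have hj := le_of_notMem_notLeIdeal_right hu hu'
  obtain ⟨c, hc⟩ := B.sub_smul_mem_right hu hu' (mul_mem_corner (B.d_mem le_rfl) (B.g_mem hj))
  obtain ⟨c', hc'⟩ := B.sub_smul_mem hk ha ha' (B.d_mem hk)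
  obtain ⟨c₁, h₁⟩ := B.sub_smul_mem le_rfl (B.d_mem (le_refl l)) (B.d_notMem le_rfl)
    (idem_mem_corner he l)
  refine B.basis_notMem he hk hj ?_
  have hg1 : g l j - (c₁ * c) • u ∈ notLeIdeal K e l := by
    have h2 := traceIdeal_mul_right (g l j) h₁
    rw [sub_mul, (B.g_mem hj).1, smul_mul_assoc] at h2
    have h3 := add_mem h2 (Submodule.smul_mem _ c₁ hc)
    rwa [smul_sub, smul_smul, sub_add_sub_cancel] at h3
  have h2 := traceIdeal_mul_left (d l k) hg1
  have h3 := traceIdeal_mul_right u hc'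
  rw [mul_sub, mul_smul_comm] at h2
  rw [sub_mul, smul_mul_assoc] at h3
  have h4 := Submodule.smul_mem _ (c₁ * c) (add_mem h3 (Submodule.smul_mem _ c' h))
  rw [sub_add_cancel] at h4
  simpa using add_mem h2 h4

theorem exists_up {l j : V} (hj : j ≤ l) (he : CompleteOrthogonalIdempotents e) :
    ∃ u ∈ corner K e l j, u ∉ notLeIdeal K e l :=
  ⟨_, mul_mem_corner (B.d_mem le_rfl) (B.g_mem hj), B.basis_notMem he le_rfl hj⟩

omit [Fintype V] in
theorem idem_notMem (l : V) : e l ∉ notLeIdeal K e l := by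
  intro h
  have := traceIdeal_mul_left (d l l) h
  rw [(B.d_mem le_rfl).2] at this
  exact B.d_notMem le_rfl this

end IsCellBasis

end CellBasis

/-! ### Embeddings of standard modules, epimorphisms of costandard modules, and the top of P(1). -/

section Socle

variable {K : Type u} [Field K] {V : Type v} {A : Type x} [Ring A] [Algebra K A] {e : V → A}
  [PartialOrder V] [BoundedOrder V]

theorem notLeIdeal_top : notLeIdeal K e (⊤ : V) = ⊥ := by
  refine Submodule.span_eq_bot.2 ?_
  rintro _ ⟨m, hm, -⟩
  exact absurd le_top hm

/-- Every vertex except `⊥` generates the ideal, so Δ(⊥) is the line spanned by the class of `e ⊥`.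
-/
theorem exists_eq_smul_of_mem_corner_bot [Fintype V] (he : CompleteOrthogonalIdempotents e)
    {d g : V → V → A} (B : IsCellBasis K e d g) {a : A} (ha : a * e ⊥ = a) :
    ∃ c : K, a - c • e ⊥ ∈ notLeIdeal K e (⊥ : V) := by
  have h1 := mul_mul_mem_corner (K := K) he ⊥ ⊥ a
  obtain ⟨c, hc⟩ := B.sub_smul_mem le_rfl (idem_mem_corner he ⊥) (B.idem_notMem ⊥) h1
  refine ⟨c, ?_⟩
  rw [mul_assoc, ha] at hc
  have h2 : ∑ k ∈ Finset.univ.erase (⊥ : V), e k * a ∈ notLeIdeal K e (⊥ : V) := by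
    refine sum_mem fun k hk => ?_
    refine mem_traceIdeal_of_left (K := K) (e := e) (k := k) (j := ⊥) ?_ ?_
    · exact fun h => (Finset.mem_erase.1 hk).1 (le_bot_iff.1 h)
    · have := mul_mul_mem_corner (K := K) he k ⊥ a
      rwa [mul_assoc, ha] at this
  have h3 := Finset.add_sum_erase Finset.univ (fun k => e k * a) (Finset.mem_univ (⊥ : V))
  rw [sum_idem_mul he] at h3
  have := add_mem hc h2
  rwa [sub_add_eq_add_sub, h3] at this

theorem exists_eq_smul_of_mem_corner_bot' [Fintype V] (he : CompleteOrthogonalIdempotents e)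
    {d g : V → V → A} (B : IsCellBasis K e d g) {a : A} (ha : e ⊥ * a = a) :
    ∃ c : K, a - c • e ⊥ ∈ notLeIdeal K e (⊥ : V) := by
  have h1 := mul_mul_mem_corner (K := K) he ⊥ ⊥ a
  obtain ⟨c, hc⟩ := B.sub_smul_mem le_rfl (idem_mem_corner he ⊥) (B.idem_notMem ⊥) h1
  refine ⟨c, ?_⟩
  rw [ha] at hc
  have h2 : ∑ k ∈ Finset.univ.erase (⊥ : V), a * e k ∈ notLeIdeal K e (⊥ : V) := by
    refine sum_mem fun k hk => ?_
    refine mem_traceIdeal_of_right (K := K) (e := e) (k := ⊥) (j := k) ?_ ?_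
    · exact fun h => (Finset.mem_erase.1 hk).1 (le_bot_iff.1 h)
    · have := mul_mul_mem_corner (K := K) he ⊥ k a
      rwa [ha] at this
  have h3 := Finset.add_sum_erase Finset.univ (fun k => a * e k) (Finset.mem_univ (⊥ : V))
  rw [sum_mul_idem he] at h3
  have := add_mem hc h2
  rwa [sub_add_eq_add_sub, h3] at this

variable [Fintype V] [FiniteDimensional K A] (he : CompleteOrthogonalIdempotents e)

include he in
/-- An embedding `Δ(i) → Δ(⊤) = P(⊤)` sends the generator to an element whose annihilator is the
kernel of `P(i) → Δ(i)`. -/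
theorem exists_mul_eq_zero_iff_left {i : V}
    (h : ∃ f : stdMod K e i →ₗ[A] stdMod K e (⊤ : V), Function.Injective f) :
    ∃ x ∈ corner K e i ⊤, ∀ a : A, a * e i = a → (a * x = 0 ↔ a ∈ notLeIdeal K e i) := by
  obtain ⟨f, hf⟩ := h
  have hei : e i ∈ projMod e i := Submodule.mem_span_singleton_self _
  obtain ⟨b, hb⟩ := Submodule.Quotient.mk_surjective _ (f (Submodule.Quotient.mk ⟨e i, hei⟩))
  have hb' := (mem_projMod he).1 b.2
  refine ⟨e i * b, ⟨by rw [← mul_assoc, (he.idem i).eq], by rw [mul_assoc, hb']⟩, ?_⟩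
  intro a ha
  have ha' : a ∈ projMod e i := (mem_projMod he).2 ha
  have h1 : (Submodule.Quotient.mk ⟨a, ha'⟩ : stdMod K e i) =
      a • Submodule.Quotient.mk ⟨e i, hei⟩ := by
    rw [← Submodule.Quotient.mk_smul]
    congr 1
    exact Subtype.ext ha.symm
  have h2 : f (Submodule.Quotient.mk ⟨a, ha'⟩) = Submodule.Quotient.mk (a • b) := by
    rw [h1, map_smul, ← hb, Submodule.Quotient.mk_smul]
  have h3 := map_eq_zero_iff f hf (x := Submodule.Quotient.mk ⟨a, ha'⟩)
  rw [h2, Submodule.Quotient.mk_eq_zero, Submodule.Quotient.mk_eq_zero, mem_stdKer he,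
    mem_stdKer he, notLeIdeal_top, Submodule.mem_bot] at h3
  rw [← mul_assoc, ha]
  exact h3

instance DualAlg.finiteDimensional : FiniteDimensional K (DualAlg K A) :=
  inferInstanceAs (FiniteDimensional K (A →ₗ[K] K))

/-- The functional `a ↦ f (e i * a)`, as an element of `I(i)`. -/
noncomputable def toInjMod (i : V) (f : A →ₗ[K] K) : injMod K e i :=
  ⟨(f ∘ₗ LinearMap.mulLeft K (e i) : A →ₗ[K] K), fun y => by
    change f (e i * (e i * y)) = f (e i * y)
    rw [← mul_assoc, (he.idem i).eq]⟩

omit [PartialOrder V] [BoundedOrder V] [FiniteDimensional K A] in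
theorem toInjMod_apply (i : V) (f : A →ₗ[K] K) (a : A) :
    (toInjMod he i f : DualAlg K A) a = f (e i * a) := rfl

-- Dual of `mem_stdKer`: S(m) is missing in a submodule of I(i) when e_m kills it, and (e_m b f)(a)
-- = f(a e_m b).
omit [BoundedOrder V] [Fintype V] in
theorem mem_costdMod {i : V} {f : injMod K e i} :
    f ∈ costdMod K e i ↔ ∀ t ∈ notLeIdeal K e i, (f : DualAlg K A) t = 0 := by
  let W : Submodule A (injMod K e i) :=
    { carrier := {f | ∀ t ∈ notLeIdeal K e i, (f : DualAlg K A) t = 0}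
      add_mem' := fun {f g} hf hg t ht => by
        rw [Submodule.coe_add, DualAlg.add_apply, hf t ht, hg t ht, add_zero]
      zero_mem' := fun t _ => by rw [Submodule.coe_zero, DualAlg.zero_apply]
      smul_mem' := fun a f hf t ht => by
        rw [Submodule.coe_smul, DualAlg.smul_apply, hf _ (traceIdeal_mul_right a ht)] }
  have hfin : ∀ N : Submodule A (injMod K e i), FiniteDimensional K N := fun N =>
    Module.Finite.of_injective ((injMod K e i).subtype.restrictScalars K ∘ₗ
      N.subtype.restrictScalars K) (Subtype.val_injective.comp Subtype.val_injective)
  have hW : costdMod K e i = W := by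
    refine le_antisymm (sSup_le fun N hN f hf t ht => ?_) (le_sSup fun k hk => ?_)
    · have hl : notLeIdeal K e i ≤ LinearMap.ker (show A →ₗ[K] K from (f : DualAlg K A)) := by
        refine Submodule.span_le.2 ?_
        rintro _ ⟨m, hm, a, b, rfl⟩
        have h1 := jhMult_eq_zero_iff.1 (hN m hm) ⟨b • f, N.smul_mem b hf⟩
        have h2 : (e m • b • (f : DualAlg K A)) a = 0 := by
          have h3 : e m • b • (f : DualAlg K A) = 0 :=
            congrArg (fun z : N => ((z : injMod K e i) : DualAlg K A)) h1
          rw [h3, DualAlg.zero_apply]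
        rwa [DualAlg.smul_apply, DualAlg.smul_apply] at h2
      exact hl ht
    · refine jhMult_eq_zero_iff.2 fun f => ?_
      refine Subtype.ext (Subtype.ext (DualAlg.ext_apply fun y => ?_))
      change (e k • ((f : injMod K e i) : DualAlg K A)) y = (0 : DualAlg K A) y
      rw [DualAlg.smul_apply, DualAlg.zero_apply]
      exact f.2 _ (Submodule.subset_span ⟨k, hk, y, 1, by rw [mul_one]⟩)
  rw [hW]
  rfl

include he in
/-- An epimorphism `∇(⊤) → ∇(i)` is dual to the multiplication with an element whose right
annihilator is the kernel of `e i * A → D(∇(i))`. -/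
theorem exists_mul_eq_zero_iff_right {i : V}
    (h : ∃ g : costdMod K e (⊤ : V) →ₗ[A] costdMod K e i, Function.Surjective g) :
    ∃ y ∈ corner K e ⊤ i, ∀ b : A, e i * b = b → (y * b = 0 ↔ b ∈ notLeIdeal K e i) := by
  obtain ⟨g, hg⟩ := h
  have htop : ∀ f, f ∈ costdMod K e (⊤ : V) := fun f => mem_costdMod.2 fun t ht => by
    rw [notLeIdeal_top, Submodule.mem_bot] at ht
    rw [ht, DualAlg.apply_zero]
  let G : (A →ₗ[K] K) → DualAlg K A := fun f => (g ⟨toInjMod he ⊤ f, htop _⟩ : injMod K e i)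
  have hGadd : ∀ f f', G (f + f') = G f + G f' := by
    intro f f'
    have h1 : (⟨toInjMod he ⊤ (f + f'), htop _⟩ : costdMod K e (⊤ : V)) =
      ⟨toInjMod he ⊤ f, htop _⟩ + ⟨toInjMod he ⊤ f', htop _⟩ := rfl
    simp only [G, h1, map_add]
    rfl
  have hGsmul : ∀ (c : K) f, G (c • f) = c • G f := by
    intro c f
    have h1 : (⟨toInjMod he ⊤ (c • f), htop _⟩ : costdMod K e (⊤ : V)) =
      c • ⟨toInjMod he ⊤ f, htop _⟩ := rfl
    simp only [G, h1]
    exact congrArg (fun z : costdMod K e i => ((z : injMod K e i) : DualAlg K A))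
      ((g.restrictScalars K).map_smul c _)
  have hGmul : ∀ (a : A) (f : A →ₗ[K] K), G (f ∘ₗ LinearMap.mulRight K a) = a • G f := by
    intro a f
    have h1 : (⟨toInjMod he ⊤ (f ∘ₗ LinearMap.mulRight K a), htop _⟩ : costdMod K e (⊤ : V)) =
        a • ⟨toInjMod he ⊤ f, htop _⟩ := by
      refine Subtype.ext (Subtype.ext (DualAlg.ext_apply fun y => ?_))
      change f (e ⊤ * y * a) = f (e ⊤ * (y * a))
      rw [mul_assoc]
    simp only [G, h1, map_smul]
    rfl
  -- By finite-dimensional biduality this functional is evaluation at some y; linearity over A then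
  -- turns `G f` into a ↦ f(y a).
  let Λ : (A →ₗ[K] K) →ₗ[K] K :=
    { toFun := fun f => G f 1
      map_add' := fun f f' => by rw [hGadd, DualAlg.add_apply]
      map_smul' := fun c f => by rw [hGsmul, DualAlg.ksmul_apply, RingHom.id_apply, smul_eq_mul] }
  obtain ⟨y, hy⟩ := (Module.evalEquiv K A).surjective Λ
  have hGy : ∀ (f : A →ₗ[K] K) (a : A), G f a = f (y * a) := by
    intro f a
    have h1 := LinearMap.congr_fun hy (f ∘ₗ LinearMap.mulRight K a)
    change f (y * a) = G (f ∘ₗ LinearMap.mulRight K a) 1 at h1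
    rw [h1, hGmul, DualAlg.smul_apply, one_mul]
  have hsep : ∀ a b : A, (∀ f : A →ₗ[K] K, f a = f b) → a = b := by
    intro a b hab
    exact (Module.forall_dual_apply_eq_zero_iff K (a - b)).1
      (fun f => by rw [map_sub, hab f, sub_self]) |> sub_eq_zero.1
  have hyc : y ∈ corner K e ⊤ i := by
    constructor
    · refine hsep _ _ fun f => ?_
      have h1 := hGy f 1
      have h2 := hGy (f ∘ₗ LinearMap.mulLeft K (e ⊤)) 1
      have h3 : G (f ∘ₗ LinearMap.mulLeft K (e ⊤)) = G f := by
        have h4 : toInjMod he ⊤ (f ∘ₗ LinearMap.mulLeft K (e ⊤)) = toInjMod he ⊤ f := by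
          refine Subtype.ext (DualAlg.ext_apply fun y => ?_)
          change f (e ⊤ * (e ⊤ * y)) = f (e ⊤ * y)
          rw [← mul_assoc, (he.idem _).eq]
        simp only [G, h4]
      rw [h3, h1, mul_one] at h2
      exact h2.symm
    · refine hsep _ _ fun f => ?_
      have h1 : G f (e i * 1) = G f 1 := (g ⟨toInjMod he ⊤ f, htop _⟩ : injMod K e i).2 1
      rw [hGy, hGy, mul_one, mul_one] at h1
      exact h1
  refine ⟨y, hyc, fun b hb => ⟨fun h0 => ?_, fun hbt => hsep _ _ fun f => ?_⟩⟩
  · by_contra hbt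
    obtain ⟨f, hf, hf'⟩ := Submodule.exists_le_ker_of_notMem hbt
    have hfc : toInjMod he i f ∈ costdMod K e i := mem_costdMod.2 fun t ht =>
      hf' (traceIdeal_mul_left (e i) ht)
    obtain ⟨F, hF⟩ := hg ⟨_, hfc⟩
    have h1 : (toInjMod he i f : DualAlg K A) = G ((F : injMod K e (⊤ : V)) : DualAlg K A) := by
      have h2 : toInjMod he ⊤ (((F : injMod K e (⊤ : V)) : DualAlg K A) : A →ₗ[K] K) = F :=
        Subtype.ext (DualAlg.ext_apply fun y => (F : injMod K e (⊤ : V)).2 y)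
      simp only [G, h2]
      change _ = ((g F : injMod K e i) : DualAlg K A)
      rw [hF]
    have h2 := hGy ((F : injMod K e (⊤ : V)) : DualAlg K A) b
    rw [← h1, h0, toInjMod_apply, hb] at h2
    exact hf (h2.trans (DualAlg.apply_zero _))
  · rw [← hGy, map_zero]
    exact mem_costdMod.1 (g ⟨toInjMod he ⊤ f, htop _⟩).2 b hbt

variable {d g : V → V → A} (B : IsCellBasis K e d g)
  (hnil : ∀ t ∈ corner K e (⊥ : V) ⊥, t ∈ notLeIdeal K e (⊥ : V) → IsNilpotent t)
include he B hnil

/-- S(⊥) is a quotient of the line Δ(⊥). This bounds the socles of the P(i) and the tops of the I(i)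
by dimension one. -/
theorem finrank_simpleMod_bot_le : Module.finrank K (simpleMod e (⊥ : V)) ≤ 1 := by
  have heb : e ⊥ ∈ projMod e (⊥ : V) := Submodule.mem_span_singleton_self _
  -- If a maximal submodule missed t, then e_⊥ = m + bt with m in it; as `e ⊥ * (b * t)` is
  -- nilpotent, m would generate P(⊥).
  have hjac : stdKer K e (⊥ : V) ≤ Module.jacobson A (projMod e (⊥ : V)) := by
    refine le_sInf fun M (hM : IsCoatom M) t ht => ?_
    by_contra htM
    have h1 : M ⊔ Submodule.span A {t} = ⊤ :=
      hM.2 _ (lt_of_le_of_ne le_sup_left fun h => htM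
        (by rw [h]; exact Submodule.mem_sup_right (Submodule.mem_span_singleton_self _)))
    have h2 : (⟨e ⊥, heb⟩ : projMod e (⊥ : V)) ∈ M ⊔ Submodule.span A {t} := by
      rw [h1]; trivial
    obtain ⟨m, hm, z, hz, hmz⟩ := Submodule.mem_sup.1 h2
    obtain ⟨b, rfl⟩ := Submodule.mem_span_singleton.1 hz
    set s : A := e ⊥ * (b * t) with hs
    have ht1 := (mem_projMod he).1 t.2
    have hsc : s ∈ corner K e (⊥ : V) ⊥ :=
      ⟨by rw [hs, ← mul_assoc, (he.idem _).eq], by rw [hs, mul_assoc, mul_assoc, ht1]⟩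
    have hsn : IsNilpotent s := hnil s hsc
      (traceIdeal_mul_left _ (traceIdeal_mul_left _ ((mem_stdKer he t).1 ht)))
    obtain ⟨w, hw⟩ := hsn.isUnit_one_sub.exists_left_inv
    have h3 : (w * e ⊥) • m = ⟨e ⊥, heb⟩ := by
      refine Subtype.ext ?_
      have h4 : (m : A) + b * t = e ⊥ := congrArg Subtype.val hmz
      have h5 : e ⊥ * (m : A) = (1 - s) * e ⊥ := by
        rw [sub_mul, one_mul, hsc.2, eq_sub_of_add_eq h4, mul_sub, (he.idem _).eq]
      change w * e ⊥ * (m : A) = e ⊥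
      rw [mul_assoc, h5, ← mul_assoc, hw, one_mul]
    refine hM.1 (eq_top_iff.2 fun a _ => ?_)
    have h4 : a = (a : A) • (⟨e ⊥, heb⟩ : projMod e (⊥ : V)) :=
      Subtype.ext ((mem_projMod he).1 a.2).symm
    rw [h4, ← h3]
    exact M.smul_mem _ (M.smul_mem _ hm)
  refine finrank_le_one (Submodule.Quotient.mk ⟨e ⊥, heb⟩) fun z => ?_
  obtain ⟨a, rfl⟩ := Submodule.Quotient.mk_surjective _ z
  obtain ⟨c, hc⟩ := exists_eq_smul_of_mem_corner_bot he B ((mem_projMod he).1 a.2)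
  refine ⟨c, ?_⟩
  have h1 : a - c • ⟨e ⊥, heb⟩ ∈ Module.jacobson A (projMod e (⊥ : V)) :=
    hjac ((mem_stdKer he _).2 hc)
  rw [← Submodule.Quotient.mk_eq_zero, Submodule.Quotient.mk_sub, sub_eq_zero] at h1
  exact h1.symm

end Socle

/-! ### Explicit generators of the socles of left and right projective modules. -/

section Socle

variable {K : Type u} [Field K] {V : Type v} {A : Type x} [Ring A] [Algebra K A] {e : V → A}
  [PartialOrder V] [BoundedOrder V]

variable (K e) in
/-- A cell basis together with elements `x i` and `y i` which represent the embeddings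
`Δ(i) → Δ(⊤)` and the epimorphisms `∇(⊤) → ∇(i)`, such that every nonzero left submodule of
`A * e i` contains `x ⊥ * y i` and every nonzero right submodule of `e i * A` contains
`x i * y ⊥`. -/
structure IsOneCellBasis (d g : V → V → A) (x y : V → A) : Prop extends IsCellBasis K e d g where
  x_mem : ∀ i, x i ∈ corner K e i ⊤
  y_mem : ∀ i, y i ∈ corner K e ⊤ i
  mul_x : ∀ {i} {a : A}, a * e i = a → (a * x i = 0 ↔ a ∈ notLeIdeal K e i)
  y_mul : ∀ {i} {b : A}, e i * b = b → (y i * b = 0 ↔ b ∈ notLeIdeal K e i)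
  left_socle : ∀ {i} {a : A}, a * e i = a → a ≠ 0 → ∃ b, b * a = x ⊥ * y i
  right_socle : ∀ {i} {a : A}, e i * a = a → a ≠ 0 → ∃ b, a * b = x i * y ⊥

variable [Fintype V] [FiniteDimensional K A] (he : CompleteOrthogonalIdempotents e)
  {d g : V → V → A} (B : IsCellBasis K e d g)

include he B in
omit [FiniteDimensional K A] in
theorem mul_ne_zero_of_mem_corner_top {k j : V} {x y : A} (hx : x ∈ corner K e k ⊤) (hx0 : x ≠ 0)
    (hy : y ∈ corner K e ⊤ j) (hy0 : y ≠ 0) : x * y ≠ 0 := by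
  have := B.mul_notMem he hx (by rwa [notLeIdeal_top]) hy (by rwa [notLeIdeal_top])
  rwa [notLeIdeal_top, Submodule.mem_bot] at this

-- J(⊥) kills x on the left, so A·xy is the line K·xy. It is simple, hence fills the socle, and
-- every nonzero submodule of the Artinian module P(i) meets the socle.
include he B in
theorem exists_mul_eq_of_socle {i : V} {x y : A} (hx : x ∈ corner K e ⊥ ⊤) (hx0 : x ≠ 0)
    (hxt : ∀ t ∈ notLeIdeal K e (⊥ : V), t * e ⊥ = t → t * x = 0) (hy : y ∈ corner K e ⊤ i)
    (hy0 : y ≠ 0) (hs : Module.finrank K (socle A (projMod e i)) ≤ 1) {a : A} (ha : a * e i = a)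
    (ha0 : a ≠ 0) : ∃ b, b * a = x * y := by
  have hxy0 := mul_ne_zero_of_mem_corner_top he B hx hx0 hy hy0
  have hxyc := mul_mem_corner hx hy
  let w : projMod e i := ⟨x * y, (mem_projMod he).2 hxyc.2⟩
  let a' : projMod e i := ⟨a, (mem_projMod he).2 ha⟩
  have hw0 : w ≠ 0 := fun h => hxy0 (congrArg Subtype.val h)
  have hsmul : ∀ b : A, ∃ c : K, b • w = c • w := by
    intro b
    obtain ⟨c, hc⟩ := exists_eq_smul_of_mem_corner_bot he B (a := b * e ⊥)
      (by rw [mul_assoc, (he.idem _).eq])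
    refine ⟨c, Subtype.ext ?_⟩
    have h1 := hxt _ hc (by
      rw [sub_mul, smul_mul_assoc, mul_assoc, (he.idem _).eq])
    rw [sub_mul, smul_mul_assoc, mul_assoc, hx.1, sub_eq_zero] at h1
    change b * (x * y) = c • (x * y)
    rw [← mul_assoc, h1, smul_mul_assoc]
  have hatom : IsAtom (Submodule.span A {w}) := by
    refine ⟨fun h => hw0 (Submodule.span_singleton_eq_bot.1 h), fun N hN => ?_⟩
    by_contra hN0
    obtain ⟨z, hz, hz0⟩ := Submodule.exists_mem_ne_zero_of_ne_bot hN0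
    obtain ⟨b, rfl⟩ := Submodule.mem_span_singleton.1 (hN.le hz)
    obtain ⟨c, hc⟩ := hsmul b
    have hc0 : c ≠ 0 := by
      rintro rfl
      rw [hc, zero_smul] at hz0
      exact hz0 rfl
    rw [hc] at hz
    have hw : w ∈ N := ((N.restrictScalars K).smul_mem_iff hc0).1 hz
    exact hN.not_ge ((Submodule.span_singleton_le_iff_mem _ _).2 hw)
  have hsoc : ∀ S : Submodule A (projMod e i), IsAtom S → S ≤ socle A (projMod e i) :=
    fun S hS => le_sSup (show IsSimpleModule A S from isSimpleModule_iff_isAtom.2 hS)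
  have : IsArtinian A (projMod e i) := isArtinian_of_tower K inferInstance
  obtain h | ⟨S, hS, hSa⟩ := eq_bot_or_exists_atom_le (Submodule.span A {a'})
  · exact absurd (congrArg Subtype.val (Submodule.span_singleton_eq_bot.1 h)) ha0
  obtain ⟨z, hz, hz0⟩ := Submodule.exists_mem_ne_zero_of_ne_bot hS.1
  have hw' : w ∈ socle A (projMod e i) := hsoc _ hatom (Submodule.mem_span_singleton_self w)
  have hfin : FiniteDimensional K (socle A (projMod e i)) :=
    Module.Finite.of_injective ((socle A (projMod e i)).subtype.restrictScalars K)
      Subtype.val_injective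
  obtain ⟨v, hv⟩ := finrank_le_one_iff.1 hs
  obtain ⟨c₁, h₁⟩ := hv ⟨z, hsoc S hS hz⟩
  obtain ⟨c₂, h₂⟩ := hv ⟨w, hw'⟩
  have hc₁ : c₁ ≠ 0 := by
    rintro rfl
    rw [zero_smul] at h₁
    exact hz0 (congrArg Subtype.val h₁).symm
  have hwz : w = (c₂ * c₁⁻¹) • z := by
    have h3 : (⟨w, hw'⟩ : socle A (projMod e i)) = (c₂ * c₁⁻¹) • ⟨z, hsoc S hS hz⟩ := by
      rw [← h₁, ← h₂, smul_smul, mul_assoc, inv_mul_cancel₀ hc₁, mul_one]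
    exact congrArg Subtype.val h3
  obtain ⟨b, hb⟩ := Submodule.mem_span_singleton.1 (hSa hz)
  refine ⟨(c₂ * c₁⁻¹) • b, ?_⟩
  have h4 := congrArg Subtype.val hwz
  rw [← hb] at h4
  rw [smul_mul_assoc]
  exact h4.symm

-- This dualises the socle argument: right submodules of e_iA correspond to their annihilators in
-- I(i), and the line K·xy to a maximal submodule `M₀`.
include he B in
theorem exists_mul_eq_of_top {i : V} {x y : A} (hx : x ∈ corner K e i ⊤) (hx0 : x ≠ 0)
    (hy : y ∈ corner K e ⊤ ⊥) (hy0 : y ≠ 0)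
    (hyt : ∀ t ∈ notLeIdeal K e (⊥ : V), e ⊥ * t = t → y * t = 0)
    (hs : Module.finrank K (Top A (injMod K e i)) ≤ 1) {a : A} (ha : e i * a = a)
    (ha0 : a ≠ 0) : ∃ b, a * b = x * y := by
  have hxy0 := mul_ne_zero_of_mem_corner_top he B hx hx0 hy hy0
  have hxyc := mul_mem_corner hx hy
  have hmul : ∀ b : A, ∃ c : K, x * y * b = c • (x * y) := by
    intro b
    obtain ⟨c, hc⟩ := exists_eq_smul_of_mem_corner_bot' he B (a := e ⊥ * b)
      (by rw [← mul_assoc, (he.idem _).eq])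
    refine ⟨c, ?_⟩
    have h1 := hyt _ hc (by
      rw [mul_sub, mul_smul_comm, ← mul_assoc, (he.idem _).eq])
    rw [mul_sub, mul_smul_comm, ← mul_assoc, hy.2, sub_eq_zero] at h1
    rw [mul_assoc, h1, mul_smul_comm]
  by_contra hcon
  have hperp : ∀ z : A, ∃ N : Submodule A (injMod K e i), ∀ f,
      f ∈ N ↔ ∀ b, (f : DualAlg K A) (z * b) = 0 := fun z =>
    ⟨{ carrier := {f | ∀ b, (f : DualAlg K A) (z * b) = 0}
       add_mem' := fun {f g} hf hg b => by
         rw [Submodule.coe_add, DualAlg.add_apply, hf b, hg b, add_zero]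
       zero_mem' := fun b => by rw [Submodule.coe_zero, DualAlg.zero_apply]
       smul_mem' := fun c f hf b => by
         rw [Submodule.coe_smul, DualAlg.smul_apply, mul_assoc, hf] }, fun f => Iff.rfl⟩
  obtain ⟨N, hN⟩ := hperp a
  obtain ⟨M₀, hM₀'⟩ := hperp (x * y)
  have hM₀ : ∀ f, f ∈ M₀ ↔ (f : DualAlg K A) (x * y) = 0 := by
    intro f
    rw [hM₀']
    constructor
    · intro h
      have := h 1
      rwa [mul_one] at this
    · intro h b
      obtain ⟨c, hc⟩ := hmul b
      rw [hc, DualAlg.apply_smul, h, mul_zero]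
  have hM₀c : IsCoatom M₀ := by
    constructor
    · intro h
      obtain ⟨f, hf⟩ : ∃ f : A →ₗ[K] K, f (x * y) ≠ 0 := by
        by_contra! h0
        exact hxy0 ((Module.forall_dual_apply_eq_zero_iff K _).1 h0)
      have h1 : toInjMod he i f ∈ M₀ := by rw [h]; trivial
      rw [hM₀, toInjMod_apply, hxyc.1] at h1
      exact hf h1
    · intro M hM
      obtain ⟨f, hfM, hf0⟩ := SetLike.exists_of_lt hM
      rw [hM₀] at hf0
      refine eq_top_iff.2 fun h _ => ?_
      set c : K := (h : DualAlg K A) (x * y) / (f : DualAlg K A) (x * y) with hc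
      have h1 : h - c • f ∈ M₀ := by
        rw [hM₀, sub_eq_add_neg, ← neg_smul, Submodule.coe_add, DualAlg.add_apply]
        change _ + ((-c) • (f : DualAlg K A)) _ = 0
        rw [DualAlg.ksmul_apply, hc, neg_mul, div_mul_cancel₀ _ hf0, add_neg_cancel]
      have h2 := M.add_mem (hM.le h1) ((M.restrictScalars K).smul_mem c hfM)
      rwa [sub_add_cancel] at h2
  have hfin : FiniteDimensional K (injMod K e i) :=
    Module.Finite.of_injective ((injMod K e i).subtype.restrictScalars K) Subtype.val_injective
  have : IsNoetherian A (injMod K e i) := isNoetherian_of_tower K inferInstance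
  obtain h | ⟨M, hM, hNM⟩ := eq_top_or_exists_le_coatom N
  · obtain ⟨f, hf⟩ : ∃ f : A →ₗ[K] K, f a ≠ 0 := by
      by_contra! h0
      exact ha0 ((Module.forall_dual_apply_eq_zero_iff K _).1 h0)
    have h1 : toInjMod he i f ∈ N := by rw [h]; trivial
    have h2 := (hN _).1 h1 1
    rw [mul_one, toInjMod_apply, ha] at h2
    exact hf h2
  -- A functional killing aA but not xy lies in `N` and outside `M₀`, hence outside the radical.
  -- Since the top is at most a line, the functional and the radical span I(i), yet both lie in `M`.
  have hxa : x * y ∉ LinearMap.range (LinearMap.mulLeft K a) := fun ⟨b, hb⟩ => hcon ⟨b, hb⟩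
  obtain ⟨f, hf, hf'⟩ := Submodule.exists_le_ker_of_notMem hxa
  have hfN : toInjMod he i f ∈ N := by
    rw [hN]
    intro b
    rw [toInjMod_apply, ← mul_assoc, ha]
    exact hf' ⟨b, rfl⟩
  have hfJ : toInjMod he i f ∉ Module.jacobson A (injMod K e i) := by
    intro h
    have h1 := (hM₀ _).1 ((sInf_le hM₀c : Module.jacobson A (injMod K e i) ≤ M₀) h)
    rw [toInjMod_apply, hxyc.1] at h1
    exact hf h1
  obtain ⟨v, hv⟩ := finrank_le_one_iff.1 hs
  refine hM.1 (eq_top_iff.2 fun h _ => ?_)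
  obtain ⟨c₁, h₁⟩ := hv (Submodule.Quotient.mk (toInjMod he i f))
  obtain ⟨c₂, h₂⟩ := hv (Submodule.Quotient.mk h)
  have hc₁ : c₁ ≠ 0 := by
    rintro rfl
    rw [zero_smul] at h₁
    exact hfJ ((Submodule.Quotient.mk_eq_zero _).1 h₁.symm)
  have h3 : h - (c₂ * c₁⁻¹) • toInjMod he i f ∈ Module.jacobson A (injMod K e i) := by
    rw [← Submodule.Quotient.mk_eq_zero, Submodule.Quotient.mk_sub, sub_eq_zero]
    change _ = (c₂ * c₁⁻¹) • (Submodule.Quotient.mk (toInjMod he i f) : Top A (injMod K e i))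
    rw [← h₁, ← h₂, smul_smul, mul_assoc, inv_mul_cancel₀ hc₁, mul_one]
  have h4 := M.add_mem ((sInf_le hM : Module.jacobson A (injMod K e i) ≤ M) h3)
    ((M.restrictScalars K).smul_mem (c₂ * c₁⁻¹) (hNM hfN))
  rwa [sub_add_cancel] at h4

include he in
theorem IsOneQuasiHereditary.exists_isOneCellBasis (hA : IsOneQuasiHereditary K e)
    (hnil : ∀ t ∈ corner K e (⊥ : V) ⊥, t ∈ notLeIdeal K e (⊥ : V) → IsNilpotent t) :
    ∃ (d g : V → V → A) (x y : V → A), IsOneCellBasis K e d g x y := by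
  obtain ⟨d, g, B⟩ := exists_isCellBasis he hA.toIsQuasiHereditary hA.std_mult hA.proj_mult
  choose x hx hx' using fun i => exists_mul_eq_zero_iff_left he (hA.std_embeds i)
  choose y hy hy' using fun i => exists_mul_eq_zero_iff_right he (hA.costd_onto i)
  have hx0 : ∀ i, x i ≠ 0 := fun i h =>
    B.idem_notMem i ((hx' i _ (he.idem i)).1 (by rw [h, mul_zero]))
  have hy0 : ∀ i, y i ≠ 0 := fun i h =>
    B.idem_notMem i ((hy' i _ (he.idem i)).1 (by rw [h, zero_mul]))
  have h1 := finrank_simpleMod_bot_le he B hnil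
  have hsoc : ∀ i, Module.finrank K (socle A (projMod e i)) ≤ 1 := by
    intro i
    obtain ⟨Φ⟩ := hA.socle_proj i
    rw [(Φ.restrictScalars K).finrank_eq]
    exact h1
  have htop : ∀ i, Module.finrank K (Top A (injMod K e i)) ≤ 1 := by
    intro i
    obtain ⟨Φ⟩ := hA.top_inj i
    rw [(Φ.restrictScalars K).finrank_eq]
    exact h1
  refine ⟨d, g, x, y, { B with
    x_mem := hx, y_mem := hy, mul_x := fun {i a} => hx' i a, y_mul := fun {i b} => hy' i b
    left_socle := fun {i a} => ?_, right_socle := fun {i a} => ?_ }⟩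
  · exact exists_mul_eq_of_socle he B (hx ⊥) (hx0 ⊥) (fun t ht ht' => (hx' _ t ht').2 ht)
      (hy i) (hy0 i) (hsoc i)
  · exact exists_mul_eq_of_top he B (hx i) (hx0 i) (hy ⊥) (hy0 ⊥)
      (fun t ht ht' => (hy' _ t ht').2 ht) (htop i)

end Socle

/-! ### Down and up elements: products, cancellation and divisibility. -/

section Elements

variable {K : Type u} [Field K] {V : Type v} {A : Type x} [Ring A] [Algebra K A] {e : V → A}
  [PartialOrder V]

variable (K e) in
/-- The elements of `e k * A * e i` which are nonzero in `Δ(i)`. -/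
structure IsDownElt (i k : V) (a : A) : Prop where
  mem : a ∈ corner K e k i
  notMem : a ∉ notLeIdeal K e i

variable (K e) in
/-- The elements of `e i * A * e j` which are nonzero in the dual of `∇(i)`. -/
structure IsUpElt (j i : V) (a : A) : Prop where
  mem : a ∈ corner K e i j
  notMem : a ∉ notLeIdeal K e i

theorem IsDownElt.le {i k : V} {a : A} (h : IsDownElt K e i k a) : k ≤ i :=
  le_of_notMem_notLeIdeal_left h.mem h.notMem

theorem IsUpElt.le {j i : V} {a : A} (h : IsUpElt K e j i a) : j ≤ i :=
  le_of_notMem_notLeIdeal_right h.mem h.notMem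

namespace IsCellBasis

variable {D G : V → V → A} [Fintype V] (B : IsCellBasis K e D G)
  (he : CompleteOrthogonalIdempotents e)
include B

omit [Fintype V] in
theorem exists_isDownElt {i k : V} (h : k ≤ i) : ∃ a, IsDownElt K e i k a :=
  ⟨D i k, B.d_mem h, B.d_notMem h⟩

include he in
theorem exists_isUpElt {j i : V} (h : j ≤ i) : ∃ a, IsUpElt K e j i a :=
  let ⟨u, hu, hu'⟩ := B.exists_up h he
  ⟨u, hu, hu'⟩

include he in
theorem mem_span_of_mem_notLeIdeal {l k : V} {a : A} (ha : a ∈ corner K e k l)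
    (ha' : a ∈ notLeIdeal K e l) :
    a ∈ Submodule.span K ((fun m => D m k * G m l) '' {m | l < m ∧ k ≤ m}) := by
  have h := B.mem_span_of_mem_traceIdeal he (isUpperSet_notLe l) (k := k) (j := l) ha'
  rw [ha.1, ha.2] at h
  refine Submodule.span_mono (Set.image_mono ?_) h
  rintro m ⟨h1, h2, h3⟩
  exact ⟨lt_of_le_of_ne h2 fun h => h1 h.ge, h3⟩

-- On e_kAe_l, "not below l" can be sharpened to "strictly above l", because the basis elements of
-- P(l) only use vertices above l.
include he in
theorem mem_traceIdeal_gt {l k : V} {a : A} (ha : a ∈ corner K e k l)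
    (ha' : a ∈ notLeIdeal K e l) : a ∈ traceIdeal K e {m | l < m} := by
  refine Submodule.span_le.2 ?_ (B.mem_span_of_mem_notLeIdeal he ha ha')
  rintro _ ⟨m, ⟨h1, h2⟩, rfl⟩
  exact mul_mem_traceIdeal h1 (B.d_mem h2) _

end IsCellBasis

namespace IsOneCellBasis

variable [BoundedOrder V] [Fintype V] {D G : V → V → A} {x y : V → A}
  (B : IsOneCellBasis K e D G x y) (he : CompleteOrthogonalIdempotents e)
include B

section

include he

theorem x_ne_zero (i : V) : x i ≠ 0 := fun h =>
  B.idem_notMem i ((B.mul_x (he.idem i)).1 (by rw [h, mul_zero]))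

theorem y_ne_zero (i : V) : y i ≠ 0 := fun h =>
  B.idem_notMem i ((B.y_mul (he.idem i)).1 (by rw [h, zero_mul]))

theorem exists_eq_smul_x {k : V} {a : A} (ha : a ∈ corner K e k ⊤) : ∃ c : K, a = c • x k := by
  obtain ⟨c, hc⟩ := B.sub_smul_mem le_top (B.x_mem k)
    (by rw [notLeIdeal_top]; exact B.x_ne_zero he k) ha
  rw [notLeIdeal_top, Submodule.mem_bot, sub_eq_zero] at hc
  exact ⟨c, hc⟩

theorem exists_eq_smul_y {j : V} {a : A} (ha : a ∈ corner K e ⊤ j) : ∃ c : K, a = c • y j := by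
  obtain ⟨c, hc⟩ := B.sub_smul_mem_right (B.y_mem j)
    (by rw [notLeIdeal_top]; exact B.y_ne_zero he j) ha
  rw [notLeIdeal_top, Submodule.mem_bot, sub_eq_zero] at hc
  exact ⟨c, hc⟩

/-- The space e_kAe_⊤ is a line, because J(⊤) = 0, and the annihilator of `x i` in Ae_i is exactly
the part in J(i). -/
theorem down_mul_x {i k : V} {d : A} (hd : IsDownElt K e i k d) :
    ∃ c : K, c ≠ 0 ∧ d * x i = c • x k := by
  obtain ⟨c, hc⟩ := B.exists_eq_smul_x he (mul_mem_corner hd.mem (B.x_mem i))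
  refine ⟨c, ?_, hc⟩
  rintro rfl
  rw [zero_smul] at hc
  exact hd.notMem ((B.mul_x hd.mem.2).1 hc)

theorem y_mul_up {j i : V} {u : A} (hu : IsUpElt K e j i u) :
    ∃ c : K, c ≠ 0 ∧ y i * u = c • y j := by
  obtain ⟨c, hc⟩ := B.exists_eq_smul_y he (mul_mem_corner (B.y_mem i) hu.mem)
  refine ⟨c, ?_, hc⟩
  rintro rfl
  rw [zero_smul] at hc
  exact hu.notMem ((B.y_mul hu.mem.1).1 hc)

/-- Right multiplication with a down element induces an injective map `Δ(k) → Δ(i)`. -/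
theorem mul_down_mem_iff {i k : V} {d a : A} (hd : IsDownElt K e i k d) (ha : a * e k = a) :
    a * d ∈ notLeIdeal K e i ↔ a ∈ notLeIdeal K e k := by
  obtain ⟨c, hc, h⟩ := B.down_mul_x he hd
  rw [← B.mul_x ha, ← B.mul_x (by rw [mul_assoc, hd.mem.2]), mul_assoc, h, mul_smul_comm,
    smul_eq_zero_iff_right hc]

theorem up_mul_mem_iff {j i : V} {u b : A} (hu : IsUpElt K e j i u) (hb : e j * b = b) :
    u * b ∈ notLeIdeal K e i ↔ b ∈ notLeIdeal K e j := by
  obtain ⟨c, hc, h⟩ := B.y_mul_up he hu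
  rw [← B.y_mul hb, ← B.y_mul (by rw [← mul_assoc, hu.mem.1]), ← mul_assoc, h, smul_mul_assoc,
    smul_eq_zero_iff_right hc]

theorem isDownElt_mul {i k m : V} {d d' : A} (hd : IsDownElt K e i k d)
    (hd' : IsDownElt K e k m d') : IsDownElt K e i m (d' * d) :=
  ⟨mul_mem_corner hd'.mem hd.mem,
    fun h => hd'.notMem ((B.mul_down_mem_iff he hd hd'.mem.2).1 h)⟩

theorem isUpElt_mul {j i l : V} {u u' : A} (hu : IsUpElt K e j i u) (hu' : IsUpElt K e i l u') :
    IsUpElt K e j l (u' * u) :=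
  ⟨mul_mem_corner hu'.mem hu.mem, fun h => hu.notMem ((B.up_mul_mem_iff he hu' hu.mem.1).1 h)⟩

theorem x_mul_y_ne_zero (k j : V) : x k * y j ≠ 0 :=
  mul_ne_zero_of_mem_corner_top he B.toIsCellBasis (B.x_mem k) (B.x_ne_zero he k) (B.y_mem j)
    (B.y_ne_zero he j)

/-- The kernel of P(i) → P(j) would contain the socle element `x ⊥ * y i`, which is sent to a
nonzero multiple of `x ⊥ * y j`. -/
theorem eq_zero_of_mul_up_eq_zero {j i : V} {u a : A} (hu : IsUpElt K e j i u) (ha : a * e i = a)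
    (h : a * u = 0) : a = 0 := by
  by_contra h0
  obtain ⟨b, hb⟩ := B.left_socle ha h0
  obtain ⟨c, hc, hcu⟩ := B.y_mul_up he hu
  have h1 : x ⊥ * y i * u = 0 := by rw [← hb, mul_assoc, h, mul_zero]
  rw [mul_assoc, hcu, mul_smul_comm, smul_eq_zero_iff_right hc] at h1
  exact B.x_mul_y_ne_zero he ⊥ j h1

theorem eq_zero_of_down_mul_eq_zero {i k : V} {d b : A} (hd : IsDownElt K e i k d)
    (hb : e i * b = b) (h : d * b = 0) : b = 0 := by
  by_contra h0
  obtain ⟨a, ha⟩ := B.right_socle hb h0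
  obtain ⟨c, hc, hcd⟩ := B.down_mul_x he hd
  have h1 : d * (x i * y ⊥) = 0 := by rw [← ha, ← mul_assoc, h, zero_mul]
  rw [← mul_assoc, hcd, smul_mul_assoc, smul_eq_zero_iff_right hc] at h1
  exact B.x_mul_y_ne_zero he k ⊥ h1

variable [FiniteDimensional K A]

/-- Right multiplication by u is injective, and `hk` says that source and target have the same
dimension: the pairs (i, k) and (j, k) have the same common upper bounds. -/
theorem exists_mul_up_eq {j i k : V} {u a : A} (hu : IsUpElt K e j i u)
    (hk : ∀ l, j ≤ l → k ≤ l → i ≤ l) (ha : a ∈ corner K e k j) :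
    ∃ b ∈ corner K e k i, b * u = a := by
  let f : corner K e k i →ₗ[K] corner K e k j :=
    (LinearMap.mulRight K u).restrict fun b hb => mul_mem_corner hb hu.mem
  have hf : Function.Injective f := by
    refine (injective_iff_map_eq_zero f).2 fun b hb => Subtype.ext ?_
    exact B.eq_zero_of_mul_up_eq_zero he hu b.2.2 (congrArg Subtype.val hb)
  have hdim : Module.finrank K (corner K e k i) = Module.finrank K (corner K e k j) := by
    rw [B.finrank_corner, B.finrank_corner]
    congr 2
    ext l
    exact ⟨fun h => ⟨hu.le.trans h.1, h.2⟩, fun h => ⟨hk l h.1 h.2, h.2⟩⟩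
  obtain ⟨b, hb⟩ :=
    (LinearMap.injective_iff_surjective_of_finrank_eq_finrank hdim).1 hf ⟨a, ha⟩
  exact ⟨b, b.2, congrArg Subtype.val hb⟩

/-- Since m ≤ i ≤ k, both spaces have dimension equal to the number of vertices above k, so the
injection is onto. -/
theorem exists_down_mul_eq {m i k : V} {d a : A} (hd : IsDownElt K e i m d)
    (hk : i ≤ k) (ha : a ∈ corner K e m k) : ∃ b ∈ corner K e i k, d * b = a := by
  let f : corner K e i k →ₗ[K] corner K e m k :=
    (LinearMap.mulLeft K d).restrict fun b hb => mul_mem_corner hd.mem hb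
  have hf : Function.Injective f := by
    refine (injective_iff_map_eq_zero f).2 fun b hb => Subtype.ext ?_
    exact B.eq_zero_of_down_mul_eq_zero he hd b.2.1 (congrArg Subtype.val hb)
  have hdim : Module.finrank K (corner K e i k) = Module.finrank K (corner K e m k) := by
    rw [B.finrank_corner, B.finrank_corner]
    congr 2
    ext l
    exact ⟨fun h => ⟨h.1, hd.le.trans h.2⟩, fun h => ⟨h.1, hk.trans h.1⟩⟩
  obtain ⟨b, hb⟩ :=
    (LinearMap.injective_iff_surjective_of_finrank_eq_finrank hdim).1 hf ⟨a, ha⟩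
  exact ⟨b, b.2, congrArg Subtype.val hb⟩

/-- The module `e ⊥ * A * e i` over `e ⊥ * A * e ⊥` is generated by any down element. -/
theorem exists_mul_down_eq_bot {i : V} {d a : A} (hd : IsDownElt K e i ⊥ d)
    (ha : a ∈ corner K e ⊥ i) : ∃ c ∈ corner K e ⊥ ⊥, c * d = a := by
  obtain ⟨lam, hlam⟩ : ∃ lam : A →ₗ[K] K, lam (x ⊥ * y ⊥) ≠ 0 := by
    by_contra! h0
    exact B.x_mul_y_ne_zero he ⊥ ⊥ ((Module.forall_dual_apply_eq_zero_iff K _).1 h0)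
  -- The pairing (z, b) ↦ `lam (z * b)` is nondegenerate in z, since z times some b hits the socle
  -- element `x ⊥ * y ⊥`.
  have hnd : ∀ {l : V} {z : A}, z ∈ corner K e ⊥ l → z ≠ 0 →
      ∃ b ∈ corner K e l ⊥, lam (z * b) ≠ 0 := by
    intro l z hz hz0
    obtain ⟨b, hb⟩ := B.right_socle hz.1 hz0
    refine ⟨e l * b * e ⊥, mul_mul_mem_corner he l ⊥ b, ?_⟩
    rwa [← mul_assoc, ← mul_assoc, hz.2, hb, mul_assoc, (B.y_mem ⊥).2]
  let P : corner K e (⊥ : V) ⊥ →ₗ[K] Module.Dual K (corner K e (⊥ : V) ⊥) :=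
    LinearMap.mk₂ K (fun c b => lam ((c : A) * b))
      (fun _ _ _ => by rw [Submodule.coe_add, add_mul, map_add])
      (fun _ _ _ => by rw [Submodule.coe_smul, smul_mul_assoc, map_smul])
      (fun _ _ _ => by rw [Submodule.coe_add, mul_add, map_add])
      (fun _ _ _ => by rw [Submodule.coe_smul, mul_smul_comm, map_smul])
  have hP : Function.Injective P := by
    refine (injective_iff_map_eq_zero P).2 fun c hc => ?_
    by_contra h0
    obtain ⟨b, hb, hb'⟩ := hnd c.2 fun h => h0 (Subtype.ext h)
    exact hb' (LinearMap.congr_fun hc ⟨b, hb⟩)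
  have hPs := (LinearMap.injective_iff_surjective_of_finrank_eq_finrank
    Subspace.dual_finrank_eq.symm).1 hP
  let f : corner K e i ⊥ →ₗ[K] corner K e (⊥ : V) ⊥ :=
    (LinearMap.mulLeft K d).restrict fun b hb => mul_mem_corner hd.mem hb
  have hf : LinearMap.ker f = ⊥ := by
    refine LinearMap.ker_eq_bot'.2 fun b hb => Subtype.ext ?_
    exact B.eq_zero_of_down_mul_eq_zero he hd b.2.1 (congrArg Subtype.val hb)
  obtain ⟨r, hr⟩ := LinearMap.exists_leftInverse_of_injective f hf
  -- The functional b ↦ `lam (a * b)` is carried along the injection b ↦ `d * b` and extended to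
  -- e_⊥Ae_⊥, where c represents it. Then cd and a pair equally with every b.
  obtain ⟨c, hc⟩ := hPs (lam ∘ₗ LinearMap.mulLeft K a ∘ₗ (corner K e i ⊥).subtype ∘ₗ r)
  refine ⟨c, c.2, ?_⟩
  by_contra hne
  obtain ⟨b, hb, hb'⟩ := hnd (sub_mem (mul_mem_corner c.2 hd.mem) ha) (sub_ne_zero.2 hne)
  apply hb'
  have h1 := LinearMap.congr_fun hc (f ⟨b, hb⟩)
  have h2 : r (f ⟨b, hb⟩) = ⟨b, hb⟩ := LinearMap.congr_fun hr _
  simp only [LinearMap.comp_apply, h2] at h1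
  rw [sub_mul, map_sub, sub_eq_zero, mul_assoc]
  exact h1

/-- A down element from m to ⊥ moves the problem to the vertex ⊥, where it is solved, and can be
cancelled afterwards. -/
theorem exists_mul_down_eq {i k m : V} {d a : A} (hd : IsDownElt K e i k d) (hm : m ≤ k)
    (ha : a ∈ corner K e m i) : ∃ b ∈ corner K e m k, b * d = a := by
  obtain ⟨dk, hdk⟩ := B.exists_isDownElt (bot_le : ⊥ ≤ k)
  obtain ⟨dm, hdm⟩ := B.exists_isDownElt (bot_le : ⊥ ≤ m)
  obtain ⟨s, hs, hsa⟩ := B.exists_mul_down_eq_bot he (B.isDownElt_mul he hd hdk)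
    (mul_mem_corner hdm.mem ha)
  obtain ⟨b, hb, hbs⟩ := B.exists_down_mul_eq he hdm hm (mul_mem_corner hs hdk.mem)
  refine ⟨b, hb, sub_eq_zero.1 (B.eq_zero_of_down_mul_eq_zero he hdm ?_ ?_)⟩
  · exact (sub_mem (mul_mem_corner hb hd.mem) ha).1
  · rw [mul_sub, ← mul_assoc, hbs, mul_assoc, hsa, sub_self]

/-! ### Comparison of the submodules generated by products of up and down elements -/

/-- Divide twice: u' = cu because i ≤ i', then d'c = bd because k' ≤ k. -/
theorem exists_mul_eq_of_le {j i i' k k' : V} {u u' d d' : A} (hu : IsUpElt K e j i u)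
    (hd : IsDownElt K e i k d) (hu' : IsUpElt K e j i' u') (hd' : IsDownElt K e i' k' d')
    (hi : i ≤ i') (hk : k' ≤ k) : ∃ b, b * (d * u) = d' * u' := by
  obtain ⟨c, hc, hcu⟩ := B.exists_mul_up_eq he hu (fun l _ h => hi.trans h) hu'.mem
  obtain ⟨b, -, hb⟩ := B.exists_mul_down_eq he hd hk (mul_mem_corner hd'.mem hc)
  exact ⟨b, by rw [← mul_assoc, hb, mul_assoc, hcu]⟩

omit [FiniteDimensional K A] in
-- The left side passes through i. If i ≰ i', it lies in J(i'), whereas d'u' does not.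
theorem le_of_mul_eq {j i i' k k' : V} {u u' d d' b : A} (hd : IsDownElt K e i k d)
    (hu' : IsUpElt K e j i' u') (hd' : IsDownElt K e i' k' d')
    (h : b * (d * u) = d' * u') : i ≤ i' := by
  by_contra hi
  refine B.mul_notMem he hd'.mem hd'.notMem hu'.mem hu'.notMem ?_
  rw [← h]
  exact traceIdeal_mul_left b (mul_mem_traceIdeal hi hd.mem u)

omit [FiniteDimensional K A] in
-- Cancelling u leaves bd = d', so the component of b in e_{k'}Ae_k survives in Δ(k).
theorem le_of_mul_eq_same {j i k k' : V} {u d d' b : A} (hu : IsUpElt K e j i u)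
    (hd : IsDownElt K e i k d) (hd' : IsDownElt K e i k' d')
    (h : b * (d * u) = d' * u) : k' ≤ k := by
  by_contra hk
  have h1 : b * d = d' := by
    refine sub_eq_zero.1 (B.eq_zero_of_mul_up_eq_zero he hu ?_ ?_)
    · rw [sub_mul, mul_assoc, hd.mem.2, hd'.mem.2]
    · rw [sub_mul, mul_assoc, h, sub_self]
  have h2 : e k' * b * e k * d = d' := by
    rw [mul_assoc, hd.mem.1, mul_assoc, h1, hd'.mem.1]
  apply hd'.notMem
  rw [← h2, B.mul_down_mem_iff he hd (by rw [mul_assoc, (he.idem k).eq])]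
  exact mem_traceIdeal_of_left hk (mul_mul_mem_corner he k' k b)

/-! ### Finiteness of the submodule lattice of `P(j)` -/

/-- Take l maximal with z = w u_l. If w were in J(l), it would be a combination of cells above the
next vertex `m₀` of the chain, and z would be divisible by u_{m₀}. So w is a down element, and
multiples of it exhaust e_kAe_l. -/
theorem exists_index_of_mem_corner {j k : V}
    (hj : ∀ i ∈ Set.Ici j, ∀ i' ∈ Set.Ici j, i ≤ i' ∨ i' ≤ i) {u : V → A}
    (hu : ∀ l, j ≤ l → IsUpElt K e j l (u l)) {z : A} (hz : z ∈ corner K e k j) (hz0 : z ≠ 0) :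
    ∃ l, j ≤ l ∧ (∃ w ∈ corner K e k l, w * u l = z) ∧
      ∀ w ∈ corner K e k l, ∃ b, b * z = w * u l := by
  let T : Set V := {l | j ≤ l ∧ ∃ w ∈ corner K e k l, w * u l = z}
  have hT : T.Nonempty :=
    ⟨j, le_rfl, B.exists_mul_up_eq he (hu j le_rfl) (fun _ h _ => h) hz⟩
  obtain ⟨l, hl⟩ := T.toFinite.exists_maximal hT
  obtain ⟨hjl, w, hw, hwz⟩ := hl.prop
  by_cases hwl : w ∈ notLeIdeal K e l
  · exfalso
    have hws := B.mem_span_of_mem_notLeIdeal he hw hwl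
    have hne : {m | l < m}.Nonempty := by
      by_contra hemp
      rw [Set.not_nonempty_iff_eq_empty] at hemp
      have h0 : {m | l < m ∧ k ≤ m} = ∅ :=
        Set.subset_empty_iff.1 fun m hm => hemp.subset (show m ∈ {m | l < m} from hm.1)
      rw [h0, Set.image_empty, Submodule.span_empty, Submodule.mem_bot] at hws
      rw [hws, zero_mul] at hwz
      exact hz0 hwz.symm
    obtain ⟨m₀, hm₀⟩ := (Set.toFinite {m | l < m}).exists_minimal hne
    have hlm₀ : l < m₀ := hm₀.prop
    have hle : Submodule.span K ((fun m => D m k * G m l) '' {m | l < m ∧ k ≤ m}) ≤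
        ((corner K e k m₀).map (LinearMap.mulRight K (u m₀))).comap
          (LinearMap.mulRight K (u l)) := by
      refine Submodule.span_le.2 ?_
      rintro _ ⟨m, ⟨hlm, hkm⟩, rfl⟩
      have hmm : m₀ ≤ m := by
        rcases hj m₀ (hjl.trans hlm₀.le) m (hjl.trans hlm.le) with h | h
        · exact h
        · exact hm₀.le_of_le hlm h
      obtain ⟨b, hb, hbu⟩ := B.exists_mul_up_eq he (hu m₀ (hjl.trans hlm₀.le))
        (fun _ _ h => hmm.trans h) (mul_mem_corner (B.g_mem hlm.le) (hu l hjl).mem)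
      refine ⟨D m k * b, mul_mem_corner (B.d_mem hkm) hb, ?_⟩
      simp only [LinearMap.mulRight_apply]
      rw [mul_assoc, hbu, mul_assoc]
    obtain ⟨w', hw', hw'z⟩ := hle hws
    have hm₀T : m₀ ∈ T := ⟨hjl.trans hlm₀.le, w', hw', by
      simp only [LinearMap.mulRight_apply] at hw'z
      rw [hw'z, hwz]⟩
    exact hlm₀.not_ge (hl.le_of_ge hm₀T hlm₀.le)
  · refine ⟨l, hjl, ⟨w, hw, hwz⟩, fun w' hw' => ?_⟩
    obtain ⟨b, -, hb⟩ := B.exists_mul_down_eq he ⟨hw, hwl⟩ le_rfl hw'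
    exact ⟨b, by rw [← hwz, ← mul_assoc, hb]⟩

theorem finite_submodule {j : V} (hj : ∀ i ∈ Set.Ici j, ∀ i' ∈ Set.Ici j, i ≤ i' ∨ i' ≤ i) :
    Finite (Submodule A (projMod e j)) := by
  have hex : ∀ l, ∃ u : A, j ≤ l → IsUpElt K e j l u := by
    intro l
    by_cases h : j ≤ l
    · obtain ⟨u, hu⟩ := B.exists_isUpElt he h
      exact ⟨u, fun _ => hu⟩
    · exact ⟨0, fun h' => absurd h' h⟩
  choose u hu using hex
  -- A submodule is recovered from the pairs (k, l) with e_kAe_l u_l inside it; the values at l ≱ j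
  -- are harmless.
  let code : Submodule A (projMod e j) → V → Set V := fun N k =>
    {l | ∀ w ∈ corner K e k l, w * u l ∈ N.map (projMod e j).subtype}
  have hle : ∀ N N', code N = code N' → N ≤ N' := by
    intro N N' h z hz
    have key : ∀ k, e k * (z : A) ∈ N'.map (projMod e j).subtype := by
      intro k
      by_cases h0 : e k * (z : A) = 0
      · rw [h0]; exact zero_mem _
      have hzc : e k * (z : A) ∈ corner K e k j := by
        have := mul_mul_mem_corner (K := K) he k j (z : A)
        rwa [mul_assoc, (mem_projMod he).1 z.2] at this
      obtain ⟨l, hjl, ⟨w, hw, hwz⟩, hl⟩ := B.exists_index_of_mem_corner he hj hu hzc h0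
      have hlN : l ∈ code N k := by
        intro w' hw'
        obtain ⟨b, hb⟩ := hl w' hw'
        rw [← hb]
        exact Submodule.smul_mem _ b (Submodule.smul_mem _ (e k) ⟨z, hz, rfl⟩)
      rw [h] at hlN
      rw [← hwz]
      exact hlN w hw
    have hzN : (z : A) ∈ N'.map (projMod e j).subtype := by
      rw [← sum_idem_mul he (z : A)]
      exact sum_mem fun k _ => key k
    obtain ⟨z', hz', h'⟩ := hzN
    rwa [← Subtype.ext h']
  exact Finite.of_injective code fun N N' h => le_antisymm (hle N N' h) (hle N' N h.symm)

-- The element p survives only in the layer of i and q only in that of i'. Modulo J(⊥), any a acts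
-- on both by one scalar c, so a(p + tq) = p + sq forces c = 1 and s = t.
omit [FiniteDimensional K A] in
theorem infinite_submodule [Infinite K] {j i i' : V} (hi : j ≤ i) (hi' : j ≤ i')
    (h : ¬ i ≤ i') (h' : ¬ i' ≤ i) : Infinite (Submodule A (projMod e j)) := by
  obtain ⟨u, hu⟩ := B.exists_isUpElt he hi
  obtain ⟨u', hu'⟩ := B.exists_isUpElt he hi'
  obtain ⟨d, hd⟩ := B.exists_isDownElt (bot_le : ⊥ ≤ i)
  obtain ⟨d', hd'⟩ := B.exists_isDownElt (bot_le : ⊥ ≤ i')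
  set p := d * u with hp
  set q := d' * u' with hq
  have hpc : p ∈ corner K e ⊥ j := mul_mem_corner hd.mem hu.mem
  have hqc : q ∈ corner K e ⊥ j := mul_mem_corner hd'.mem hu'.mem
  have hpn : p ∉ notLeIdeal K e i := B.mul_notMem he hd.mem hd.notMem hu.mem hu.notMem
  have hqn : q ∉ notLeIdeal K e i' := B.mul_notMem he hd'.mem hd'.notMem hu'.mem hu'.notMem
  have hpi' : p ∈ notLeIdeal K e i' := mul_mem_traceIdeal h hd.mem u
  have hqi : q ∈ notLeIdeal K e i := mul_mem_traceIdeal h' hd'.mem u'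
  let f : K → Submodule A (projMod e j) := fun t =>
    Submodule.span A {⟨p + t • q, (mem_projMod he).2 (add_mem hpc (Submodule.smul_mem _ t hqc)).2⟩}
  refine Infinite.of_injective f fun t s hts => ?_
  have hmem : (⟨p + s • q, (mem_projMod he).2 (add_mem hpc (Submodule.smul_mem _ s hqc)).2⟩ :
      projMod e j) ∈ f t := by
    rw [hts]; exact Submodule.mem_span_singleton_self _
  obtain ⟨a, ha⟩ := Submodule.mem_span_singleton.1 hmem
  have ha' : a * (p + t • q) = p + s • q := congrArg Subtype.val ha
  have hac := mul_mul_mem_corner (K := K) he ⊥ ⊥ a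
  obtain ⟨c, hc⟩ := B.sub_smul_mem le_rfl (idem_mem_corner he ⊥) (B.idem_notMem ⊥) hac
  set τ := e ⊥ * a * e ⊥ - c • e ⊥ with hτ
  have hτc : τ ∈ corner K e ⊥ ⊥ := sub_mem hac (Submodule.smul_mem _ c (idem_mem_corner he ⊥))
  have hτp : τ * p ∈ traceIdeal K e {m | i < m} := by
    rw [hp, ← mul_assoc]
    exact traceIdeal_mul_right u (B.mem_traceIdeal_gt he (mul_mem_corner hτc hd.mem)
      ((B.mul_down_mem_iff he hd hτc.2).2 hc))
  have hτq : τ * q ∈ traceIdeal K e {m | i' < m} := by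
    rw [hq, ← mul_assoc]
    exact traceIdeal_mul_right u' (B.mem_traceIdeal_gt he (mul_mem_corner hτc hd'.mem)
      ((B.mul_down_mem_iff he hd' hτc.2).2 hc))
  have heq : (1 - c) • p + (s - c * t) • q = τ * p + t • (τ * q) := by
    have h1 : (e ⊥ * a * e ⊥) * (p + t • q) = p + s • q := by
      have h2 := add_mem hpc (Submodule.smul_mem _ t hqc)
      have h3 := add_mem hpc (Submodule.smul_mem _ s hqc)
      rw [mul_assoc, h2.1, mul_assoc, ha', h3.1]
    have h2 : τ * (p + t • q) = p + s • q - c • (p + t • q) := by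
      rw [hτ, sub_mul, h1, smul_mul_assoc, (add_mem hpc (Submodule.smul_mem _ t hqc)).1]
    rw [mul_add, mul_smul_comm] at h2
    rw [h2]
    module
  -- The error terms must vanish in both layers, which is why they are placed strictly above i and
  -- i' and not merely outside the vertices below.
  have hsub : ∀ {a b : V}, ¬ b ≤ a → {m | b < m} ⊆ {m | ¬ m ≤ a} :=
    fun hab m hm hma => hab (hm.le.trans hma)
  have hgt : ∀ a : V, {m | a < m} ⊆ {m | ¬ m ≤ a} := fun a m hm hma => hm.not_ge hma
  have h1 : (1 - c) • p ∈ notLeIdeal K e i := by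
    rw [eq_sub_of_add_eq heq]
    exact sub_mem (add_mem (traceIdeal_mono (hgt i) hτp)
      (Submodule.smul_mem _ _ (traceIdeal_mono (hsub h') hτq))) (Submodule.smul_mem _ _ hqi)
  have h2 : (s - c * t) • q ∈ notLeIdeal K e i' := by
    rw [eq_sub_of_add_eq' heq]
    exact sub_mem (add_mem (traceIdeal_mono (hsub h) hτp)
      (Submodule.smul_mem _ _ (traceIdeal_mono (hgt i') hτq))) (Submodule.smul_mem _ _ hpi')
  have hc1 : 1 - c = 0 := by
    by_contra hne
    exact hpn ((Submodule.smul_mem_iff _ hne).1 h1)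
  have hc2 : s - c * t = 0 := by
    by_contra hne
    exact hqn ((Submodule.smul_mem_iff _ hne).1 h2)
  rw [← sub_eq_zero.1 hc1, one_mul] at hc2
  exact (sub_eq_zero.1 hc2).symm

end

end IsOneCellBasis

end Elements

/-! ### Monotone paths are exactly the paths giving down or up elements. -/

section MonotonePaths

variable {K : Type u} [Field K] {V : Type v} [Fintype V] [Quiver.{w} V] [PartialOrder V]
  [BoundedOrder V] {A : Type x} [Ring A] [Algebra K A] {φ : PathAlgebra K V →ₐ[K] A}
  (hφ : IsBoundQuiverPresentation φ) {D G : V → V → A} {x y : V → A}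
  (B : IsOneCellBasis K (vertexIdem φ) D G x y)
include hφ B

/-- For an arrow l → k with k ≤ l, neither end lies in {m | m ≰ l}, so admissibility keeps the arrow
out of J(l). -/
theorem isDownElt_pathElt {i k : V} (p : Quiver.Path i k) (hp : IsDeclining p) :
    IsDownElt K (vertexIdem φ) i k (pathElt φ p) := by
  have he := completeOrthogonalIdempotents_vertexIdem φ
  induction p with
  | nil => exact ⟨idem_mem_corner he i, B.idem_notMem i⟩
  | @cons l k p α ih =>
    rw [pathElt_cons]
    refine B.isDownElt_mul he (ih hp.1) ⟨pathElt_mem_corner φ _, ?_⟩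
    exact pathElt_toPath_notMem_traceIdeal hφ (U := {m | ¬ m ≤ l}) (fun h => h le_rfl)
      (fun h => h hp.2) α

theorem isUpElt_pathElt {j i : V} (p : Quiver.Path j i) (hp : IsIncreasing p) :
    IsUpElt K (vertexIdem φ) j i (pathElt φ p) := by
  have he := completeOrthogonalIdempotents_vertexIdem φ
  induction p with
  | nil => exact ⟨idem_mem_corner he j, B.idem_notMem j⟩
  | @cons l k p α ih =>
    rw [pathElt_cons]
    refine B.isUpElt_mul he (ih hp.1) ⟨pathElt_mem_corner φ _, ?_⟩
    exact pathElt_toPath_notMem_traceIdeal hφ (U := {m | ¬ m ≤ k}) (fun h => h hp.2)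
      (fun h => h le_rfl) α

-- An initial segment of a path that is nonzero in Δ(i) is again a down element, and cancelling it
-- shows that the last arrow l → k is nonzero in Δ(l), whence k ≤ l.
omit hφ in
theorem isDeclining_of_notMem {i k : V} (p : Quiver.Path i k)
    (hp : pathElt φ p ∉ notLeIdeal K (vertexIdem φ) i) : IsDeclining p := by
  have he := completeOrthogonalIdempotents_vertexIdem φ
  induction p with
  | nil => trivial
  | @cons l k p α ih =>
    rw [pathElt_cons] at hp
    have hp' : pathElt φ p ∉ notLeIdeal K (vertexIdem φ) i := fun h =>
      hp (traceIdeal_mul_left _ h)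
    have hα := pathElt_mem_corner φ α.toPath
    rw [B.mul_down_mem_iff he ⟨pathElt_mem_corner φ p, hp'⟩ hα.2] at hp
    exact ⟨ih hp', le_of_notMem_notLeIdeal_left hα hp⟩

omit hφ in
theorem isIncreasing_of_notMem {j i : V} (p : Quiver.Path j i)
    (hp : pathElt φ p ∉ notLeIdeal K (vertexIdem φ) i) : IsIncreasing p := by
  have he := completeOrthogonalIdempotents_vertexIdem φ
  induction p with
  | nil => trivial
  | @cons l k p α ih =>
    rw [pathElt_cons] at hp
    have hα := pathElt_mem_corner φ α.toPath
    have hα' : pathElt φ α.toPath ∉ notLeIdeal K (vertexIdem φ) k := fun h =>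
      hp (traceIdeal_mul_right _ h)
    rw [B.up_mul_mem_iff he ⟨hα, hα'⟩ (pathElt_mem_corner φ p).1] at hp
    exact ⟨ih hp, le_of_notMem_notLeIdeal_right hα hα'⟩

omit [PartialOrder V] [BoundedOrder V] B in
theorem exists_path_notMem {k j : V} {a : A} (ha : a ∈ corner K (vertexIdem φ) k j)
    {U : Set V} (h : a ∉ traceIdeal K (vertexIdem φ) U) :
    ∃ p : Quiver.Path j k, pathElt φ p ∉ traceIdeal K (vertexIdem φ) U := by
  by_contra! hc
  refine h (Submodule.span_le.2 ?_ (corner_le_span_pathElt hφ k j ha))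
  rintro _ ⟨p, rfl⟩
  exact hc p

/-- Paths span e_kAe_i, so some path lies outside J(i) as soon as some element does, and such a path
is monotone. -/
theorem nonempty_pathSystem : Nonempty (PathSystem V) := by
  have he := completeOrthogonalIdempotents_vertexIdem φ
  have hup : ∀ {j i : V}, j ≤ i → ∃ p : Quiver.Path j i, IsIncreasing p := by
    intro j i h
    obtain ⟨u, hu⟩ := B.exists_isUpElt he h
    obtain ⟨p, hp⟩ := exists_path_notMem hφ hu.mem hu.notMem
    exact ⟨p, isIncreasing_of_notMem B p hp⟩
  have hdown : ∀ {i k : V}, k ≤ i → ∃ p : Quiver.Path i k, IsDeclining p := by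
    intro i k h
    obtain ⟨d, hd⟩ := B.exists_isDownElt h
    obtain ⟨p, hp⟩ := exists_path_notMem hφ hd.mem hd.notMem
    exact ⟨p, isDeclining_of_notMem B p hp⟩
  exact ⟨⟨fun h => (hup h).choose, fun h => (hdown h).choose, fun h => (hup h).choose_spec,
    fun h => (hdown h).choose_spec⟩⟩

end MonotonePaths

end OneQH

/-! ### The theorem for bound quiver algebras. -/

theorem lemma2p2 {K : Type u} [Field K] [IsAlgClosed K]
    {V : Type v} [Fintype V] [Quiver.{w} V] [PartialOrder V] [BoundedOrder V]
    {A : Type x} [Ring A] [Algebra K A] [FiniteDimensional K A]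
    (φ : OneQH.PathAlgebra K V →ₐ[K] A) (hφ : OneQH.IsBoundQuiverPresentation φ)
    (hA : OneQH.IsOneQuasiHereditary K (OneQH.vertexIdem φ)) :
    Nonempty (OneQH.PathSystem V) ∧
    (∀ (S : OneQH.PathSystem V) (j i k : V) (hj : j ≤ i) (hk : k ≤ i),
      (∀ (i' : V) (hj' : j ≤ i') (hk' : k ≤ i'),
        OneQH.gen φ (S.p hj' hk') < OneQH.gen φ (S.p hj hk) ↔ i < i') ∧
      (∀ (k' : V) (hk' : k' ≤ i),
        OneQH.gen φ (S.p hj hk') < OneQH.gen φ (S.p hj hk) ↔ k' < k)) ∧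
    (∀ j : V, Finite (Submodule A (OneQH.projMod (OneQH.vertexIdem φ) j)) ↔
      ∀ i ∈ Set.Ici j, ∀ i' ∈ Set.Ici j, i ≤ i' ∨ i' ≤ i) := by
  have he := OneQH.completeOrthogonalIdempotents_vertexIdem φ
  -- Such t factors through vertices other than ⊥, hence is a combination of nontrivial paths, and
  -- long paths vanish in A.
  have hnil : ∀ t ∈ OneQH.corner K (OneQH.vertexIdem φ) (⊥ : V) ⊥,
      t ∈ OneQH.notLeIdeal K (OneQH.vertexIdem φ) (⊥ : V) → IsNilpotent t := by
    intro t ht ht'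
    have h := OneQH.mul_mul_mem_radPow_two hφ (U := {m | ¬ m ≤ (⊥ : V)}) (fun h => h le_rfl)
      (fun h => h le_rfl) ht'
    rw [ht.1, ht.2] at h
    exact OneQH.isNilpotent_of_mem_radPow hφ (OneQH.radPow_antitone one_le_two h)
  obtain ⟨D, G, x, y, B⟩ := hA.exists_isOneCellBasis he hnil
  have hle : ∀ {a b : A}, Submodule.span A {a} ≤ Submodule.span A {b} ↔ ∃ c, c * b = a := by
    intro a b
    rw [Submodule.span_singleton_le_iff_mem, Submodule.mem_span_singleton]
    rfl
  refine ⟨OneQH.nonempty_pathSystem hφ B, fun S j i k hj hk => ⟨?_, ?_⟩, fun j => ⟨?_, ?_⟩⟩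
  · intro i' hj' hk'
    have hu := OneQH.isUpElt_pathElt hφ B _ (S.up_increasing hj)
    have hd := OneQH.isDownElt_pathElt hφ B _ (S.down_declining hk)
    have hu' := OneQH.isUpElt_pathElt hφ B _ (S.up_increasing hj')
    have hd' := OneQH.isDownElt_pathElt hφ B _ (S.down_declining hk')
    constructor
    · intro h
      refine lt_of_le_of_ne ?_ ?_
      · unfold OneQH.gen OneQH.PathSystem.p at h
        simp only [OneQH.pathElt_comp] at h
        obtain ⟨b, hb⟩ := hle.1 h.le
        exact B.le_of_mul_eq he hd hu' hd' hb
      · rintro rfl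
        exact lt_irrefl _ h
    · intro h
      unfold OneQH.gen OneQH.PathSystem.p
      simp only [OneQH.pathElt_comp]
      refine lt_of_le_not_ge (hle.2 (B.exists_mul_eq_of_le he hu hd hu' hd' h.le le_rfl)) ?_
      intro h'
      obtain ⟨b, hb⟩ := hle.1 h'
      exact h.not_ge (B.le_of_mul_eq he hd' hu hd hb)
  · intro k' hk'
    have hu := OneQH.isUpElt_pathElt hφ B _ (S.up_increasing hj)
    have hd := OneQH.isDownElt_pathElt hφ B _ (S.down_declining hk)
    have hd' := OneQH.isDownElt_pathElt hφ B _ (S.down_declining hk')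
    constructor
    · intro h
      refine lt_of_le_of_ne ?_ ?_
      · unfold OneQH.gen OneQH.PathSystem.p at h
        simp only [OneQH.pathElt_comp] at h
        obtain ⟨b, hb⟩ := hle.1 h.le
        exact B.le_of_mul_eq_same he hu hd hd' hb
      · rintro rfl
        exact lt_irrefl _ h
    · intro h
      unfold OneQH.gen OneQH.PathSystem.p
      simp only [OneQH.pathElt_comp]
      refine lt_of_le_not_ge (hle.2 (B.exists_mul_eq_of_le he hu hd hu hd' le_rfl h.le)) ?_
      intro h'
      obtain ⟨b, hb⟩ := hle.1 h'
      exact h.not_ge (B.le_of_mul_eq_same he hu hd' hd hb)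
  · intro hfin i hi i' hi'
    by_contra! h
    exact not_finite_iff_infinite.2 (B.infinite_submodule he hi hi' h.1 h.2) hfin
  · exact B.finite_submodule he
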